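/- **Setting.** Let $f_1,\dots,f_N:\mathbb{R}^d\to\mathbb{R}$ ($N\ge 1$) be quadratic functions, $f=\frac1N\sum_i f_i$, and suppose that, for some $\beta>0$, $\delta\ge 0$, $\sigma\ge 0$: each $\nabla f_i$ is $\beta$-Lipschitz; $\|\nabla^2 f_i(x)-\nabla^2 f(x)\|\le\delta$ in operator norm for all $i,x$; and for every $x$, client $i$ can sample an unbiased stochastic gradient $g_i(x)$ of $f_i$, using fresh independent randomness at each call, with $\mathbb{E}\|g_i(x)-\nabla f_i(x)\|^2\le\sigma^2$. Run SCAFFOLD with full participation, $K\ge1$ local steps per round, $R$ rounds, global step size $\eta_g=1$, local step size $\eta>0$, and full-gradient control variates taken at the current server model: for $r=1,\dots,R$, put $y_{i,0}^r=x^{r-1}$, $$y_{i,k}^r=y_{i,k-1}^r-\eta\big(g_i(y_{i,k-1}^r)-\nabla f_i(x^{r-1})+\nabla f(x^{r-1})\big)\quad(k=1,\dots,K),\qquad x^r=\tfrac1N\sum_i y_{i,K}^r .$$ Put $x_k^r=\frac1N\sum_i y_{i,k}^r$. The output is $\bar x^R=x_k^r$ with probability $p_k^r$, for $(r,k)\in\{1,\dots,R\}\times\{1,\dots,K\}$,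 the choice being independent of the samples. Let $f^\star$ be a number and $F\ge 0$ with $f(x^0)-f^\star\le F$. **Theorem.** There is an absolute constant $C>0$ such that the following holds. In each part, a step size $\eta>0$ and probabilities $p_k^r$ exist that depend only on the numerical parameters in that part (not on the dimension, the functions, the starting point or the gradient samples), with $\eta\le\frac1{10\beta}$, $22\delta K\eta\le1$, $\eta\le\frac1{15K\delta+8\beta}$ and, in the strongly convex parts, also $\eta\le\frac1{10\mu K}$. *Strongly convex.* Let every $f_i$ be $\mu$-strongly convex, $\mu>0$, and let $f\ge f^\star$ on $\mathbb{R}^d$. 1. If $RK\ge\max\big(\frac{20\beta}{\mu},\frac{44\delta K+20\mu K}{\mu}\big)$, then $$\mathbb{E}\|\nabla f(\bar x^R)\|^2\le C\Big(\frac{\beta\sigma^2}{\mu RKN}\log\Big(e+\frac{\mu^2RKNF}{\beta\sigma^2}\Big)+\mu F\exp\Big(-\frac{\mu}{20\beta+44\delta K+20\mu K}RK\Big)\Big),$$ where the first summand is $0$ if $\sigma=0$. 2. For every $\varepsilon>0$, $\mathbb{E}\|\nabla f(\bar x^R)\|^2<\varepsilon$ as soon as $$R\ge C\Big(\frac{\beta\sigma^2}{\mu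 KN\varepsilon}+\frac{\beta+\delta K}{\mu K}+1\Big)\log\Big(e+\frac{\mu F}{\varepsilon}\Big).$$ *Weakly convex.* Suppose only that $\nabla^2f\succeq-\delta I$, and that $f^\star\le f(x^R)$ almost surely (for the run with the step size of the part in question). 3. If $F>0$ and $R\ge1$, then $$\mathbb{E}\|\nabla f(\bar x^R)\|^2\le C\Big(\frac{\sigma\sqrt{\beta F}}{\sqrt{RKN}}+\frac{(\beta+\delta K)F}{RK}\Big).$$ 4. For every $\varepsilon>0$, $\mathbb{E}\|\nabla f(\bar x^R)\|^2<\varepsilon$ as soon as $R\ge1$ and $$R\ge C\Big(\frac{\beta\sigma^2F}{KN\varepsilon^2}+\frac{(\beta+\delta K)F}{K\varepsilon}\Big).$$ -/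

import Mathlib

open MeasureTheory ProbabilityTheory
open scoped Gradient

noncomputable section

/-- The parameter space `ℝ^d` with its Euclidean norm. -/
abbrev Vec (d : ℕ) : Type := EuclideanSpace ℝ (Fin d)

/-- The Hessian of `f` at `x` as a bounded operator: the derivative of the gradient map. -/
def hess {d : ℕ} (f : Vec d → ℝ) (x : Vec d) : Vec d →L[ℝ] Vec d :=
  fderiv ℝ (∇ f) x

/-- `f` is a quadratic function `x ↦ ½⟨x, A x⟩ + ⟨b, x⟩ + c` with `A` symmetric. -/
def IsQuadratic {d : ℕ} (f : Vec d → ℝ) : Prop :=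
  ∃ (A : Vec d →L[ℝ] Vec d) (b : Vec d) (c : ℝ),
    (∀ x y, inner ℝ (A x) y = inner ℝ x (A y)) ∧
    ∀ x, f x = (1 / 2) * inner ℝ x (A x) + inner ℝ b x + c

/-- `β`-smoothness: the gradient is `β`-Lipschitz. -/
def IsSmooth {d : ℕ} (β : ℝ) (f : Vec d → ℝ) : Prop :=
  ∀ x y, ‖∇ f x - ∇ f y‖ ≤ β * ‖x - y‖

/-- `μ`-convexity (strong convexity when `μ > 0`). -/
def IsMuConvex {d : ℕ} (μ : ℝ) (f : Vec d → ℝ) : Prop :=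
  ∀ x y, inner ℝ (∇ f x) (y - x) ≤ -(f x - f y + μ / 2 * ‖x - y‖ ^ 2)

/-- `δ`-weak convexity: `∇² f ≽ -δ I`. -/
def IsWeaklyConvex {d : ℕ} (δ : ℝ) (f : Vec d → ℝ) : Prop :=
  ∀ x v, -δ * ‖v‖ ^ 2 ≤ inner ℝ v (hess f x v)

/-- The global objective, the average of the client functions. -/
def avgObjective {N d : ℕ} (f : Fin N → Vec d → ℝ) : Vec d → ℝ :=
  fun x => (1 / (N : ℝ)) * ∑ i, f i x

/-- Bounded Hessian dissimilarity, in operator norm. -/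
def HasBoundedHessianDissimilarity {N d : ℕ} (δ : ℝ) (f : Fin N → Vec d → ℝ) : Prop :=
  ∀ i x, ‖hess (f i) x - hess (avgObjective f) x‖ ≤ δ

/-- `g x z` with `z` drawn from `D` is an unbiased stochastic gradient of `f` at every `x`,
with variance at most `σ²`. -/
structure IsStochasticGradient {d : ℕ} {Z : Type*} [MeasurableSpace Z] (σ : ℝ)
    (f : Vec d → ℝ) (g : Vec d → Z → Vec d) (D : Measure Z) : Prop where
  measurable : Measurable (Function.uncurry g)
  integrable : ∀ x, Integrable (g x) D
  unbiased : ∀ x, ∫ z, g x z ∂D = ∇ f x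
  integrable_sq : ∀ x, Integrable (fun z => ‖g x z - ∇ f x‖ ^ 2) D
  variance_le : ∀ x, ∫ z, ‖g x z - ∇ f x‖ ^ 2 ∂D ≤ σ ^ 2

/-- The local model `y_{i,k}` of client `i` after `k` local steps with local step size `ηl`,
in a round that starts at the server model `x`. The control variates of the round are
`c_i = ∇ f_i x` and `c = (1/N) ∑ c_j`; step `k + 1` uses the sample `z k`. -/
def localModel {N d : ℕ} {Z : Type*} (f : Fin N → Vec d → ℝ) (g : Fin N → Vec d → Z → Vec d)
    (ηl : ℝ) (x : Vec d) (i : Fin N) (z : ℕ → Z) : ℕ → Vec d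
  | 0 => x
  | k + 1 =>
      localModel f g ηl x i z k -
        ηl • (g i (localModel f g ηl x i z k) (z k) - ∇ (f i) x
          + (1 / (N : ℝ)) • ∑ j, ∇ (f j) x)

/-- The server model `x^r` after `r` rounds with full participation, `K` local steps per round
and global step size `ηg`; client `i` uses the sample `z r i k` in step `k + 1` of
round `r + 1`. -/
def serverModel {N d : ℕ} {Z : Type*} (f : Fin N → Vec d → ℝ) (g : Fin N → Vec d → Z → Vec d)
    (ηl ηg : ℝ) (K : ℕ) (x₀ : Vec d) (z : ℕ → Fin N → ℕ → Z) : ℕ → Vec d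
  | 0 => x₀
  | r + 1 =>
      serverModel f g ηl ηg K x₀ z r +
        ηg • ((1 / (N : ℝ)) • ∑ i, (localModel f g ηl (serverModel f g ηl ηg K x₀ z r) i (z r i) K
          - serverModel f g ηl ηg K x₀ z r))

/-- The average `(1/N) ∑ y_{i,k}` of the local models after `k` local steps of
round `r + 1`. -/
def avgLocalModel {N d : ℕ} {Z : Type*} (f : Fin N → Vec d → ℝ) (g : Fin N → Vec d → Z → Vec d)
    (ηl ηg : ℝ) (K : ℕ) (x₀ : Vec d) (z : ℕ → Fin N → ℕ → Z) (r k : ℕ) : Vec d :=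
  (1 / (N : ℝ)) • ∑ i, localModel f g ηl (serverModel f g ηl ηg K x₀ z r) i (z r i) k

/-- A run of SCAFFOLD with `N` clients, full participation, `K` local steps per round, `R` rounds,
local step size `ηl` and global step size `ηg`, on `β`-smooth quadratic client functions on `ℝ^d`
with `δ`-bounded Hessian dissimilarity and stochastic gradients of variance at most `σ²`. The
output is the averaged local model of a random round and local step, drawn from `p`. -/
structure ScaffoldRun (N K R d : ℕ) (β δ σ ηl ηg : ℝ) (p : PMF (Fin R × Fin K)) where
  /-- the client functions -/
  f : Fin N → Vec d → ℝ
  quadratic : ∀ i, IsQuadratic (f i)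
  smooth : ∀ i, IsSmooth β (f i)
  dissimilarity : HasBoundedHessianDissimilarity δ f
  /-- the initial server model -/
  x₀ : Vec d
  /-- the space of data samples -/
  Z : Type*
  [measurableSpaceZ : MeasurableSpace Z]
  /-- the data distribution of each client -/
  D : Fin N → Measure Z
  /-- the stochastic gradients of each client -/
  g : Fin N → Vec d → Z → Vec d
  stochasticGradient : ∀ i, IsStochasticGradient σ (f i) (g i) (D i)
  /-- the probability space of the run -/
  Ω : Type*
  [measurableSpaceΩ : MeasurableSpace Ω]
  P : Measure Ω
  [isProbabilityMeasure : IsProbabilityMeasure P]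
  /-- `ζ r i k` is the sample that client `i` draws in step `k + 1` of round `r + 1` -/
  ζ : ℕ → Fin N → ℕ → Ω → Z
  measurable_ζ : ∀ r i k, Measurable (ζ r i k)
  law_ζ : ∀ r < R, ∀ i, ∀ k < K, P.map (ζ r i k) = D i
  indep_ζ : iIndepFun (fun (t : Fin R × Fin N × Fin K) => ζ t.1 t.2.1 t.2.2) P
  /-- the random index of the output -/
  J : Ω → Fin R × Fin K
  measurable_J : Measurable J
  law_J : ∀ j, P (J ⁻¹' {j}) = p j
  indep_J : IndepFun J (fun ω (t : Fin R × Fin N × Fin K) => ζ t.1 t.2.1 t.2.2 ω) P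

namespace ScaffoldRun

attribute [instance] measurableSpaceZ measurableSpaceΩ isProbabilityMeasure

/-- The global objective `f`. -/
def obj {N K R d : ℕ} {β δ σ ηl ηg : ℝ} {p : PMF (Fin R × Fin K)}
    (S : ScaffoldRun N K R d β δ σ ηl ηg p) : Vec d → ℝ :=
  avgObjective S.f

/-- The final server model `x^R`. -/
def finalModel {N K R d : ℕ} {β δ σ ηl ηg : ℝ} {p : PMF (Fin R × Fin K)}
    (S : ScaffoldRun N K R d β δ σ ηl ηg p) (ω : S.Ω) : Vec d :=
  serverModel S.f S.g ηl ηg K S.x₀ (fun r i k => S.ζ r i k ω) R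

/-- The output of the run: the average of the local models after step `k` of round `r`, for the
random `(r, k)` in `{1, …, R} × {1, …, K}` encoded (counting from `0`) by `J`. -/
def output {N K R d : ℕ} {β δ σ ηl ηg : ℝ} {p : PMF (Fin R × Fin K)}
    (S : ScaffoldRun N K R d β δ σ ηl ηg p) (ω : S.Ω) : Vec d :=
  avgLocalModel S.f S.g ηl ηg K S.x₀ (fun r i k => S.ζ r i k ω) (S.J ω).1 ((S.J ω).2 + 1)

/-- The squared gradient norm at the output. -/
def sqGrad {N K R d : ℕ} {β δ σ ηl ηg : ℝ} {p : PMF (Fin R × Fin K)}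
    (S : ScaffoldRun N K R d β δ σ ηl ηg p) (ω : S.Ω) : ℝ :=
  ‖∇ S.obj (S.output ω)‖ ^ 2

end ScaffoldRun

end

/-! For quadratic clients a local step is affine in the local model, with linear part `A i`. The
displacement `y i k - x` within a round therefore splits exactly into a noiseless trajectory
`drift`, driven by the gradient at the server model, and a part `noisePart`, which is linear in the
gradient noise of client `i` in that round. All estimates take place in the Hilbert space of
square-integrable random vectors: expectations of products are inner products, the Hessians act
pointwise, and independence of a fresh sample becomes orthogonality of its centred noise to a
subspace.

The averaged model performs stochastic gradient descent on the average objective, up to the error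
`dissimilarityError`, the average of `(A i - mean A) (y i k - x)`. Its drift part is of size `δ η`
times a sum of gradients along the noiseless averaged path. As `δ K η` is small, its squares over a
round sum to a small fraction of the squared gradients there
(`sum_norm_mean_dissimilarity_drift_sq_le`), and orthogonality bounds these by the gradients at the
true averaged models (`norm_grad_drift_sq_le`). Its noise part averages `N` pairwise orthogonal
vectors, hence gains the factor `1 / N` and has the size `η β σ² / N` that smooth stochastic
gradient descent has anyway (`norm_mean_dissimilarity_noisePart_sq_le`). Both are absorbed in the
descent inequality summed over a round (`descent_from`).

In the weakly convex case the descent telescopes over the rounds and a uniform output gives `F / (η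
R K) + η β σ² / N`. In the strongly convex case a Polyak–Łojasiewicz inequality contracts the gap by
`exp (-μ η K / 2)` per round (`gap_contraction`), and geometric output weights matched to this
factor give `μ F exp (-μ η K R / 2) + η β σ² / N`. The rates follow by choosing `η`. -/

noncomputable section

/-! ### Averages and symmetric operators in a Hilbert space. -/

section Hilbert

variable {H : Type*} [NormedAddCommGroup H] [InnerProductSpace ℝ H] {N : ℕ}

/-- The average of a finite family of vectors. -/
def mean {M : Type*} [AddCommGroup M] [Module ℝ M] (z : Fin N → M) : M :=
  (1 / (N : ℝ)) • ∑ i, z i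

lemma mean_add {M : Type*} [AddCommGroup M] [Module ℝ M] (z w : Fin N → M) :
    mean (fun i => z i + w i) = mean z + mean w := by
  simp [mean, Finset.sum_add_distrib]

lemma mean_sub {M : Type*} [AddCommGroup M] [Module ℝ M] (z w : Fin N → M) :
    mean (fun i => z i - w i) = mean z - mean w := by
  simp [mean, Finset.sum_sub_distrib, smul_sub]

lemma mean_smul {M : Type*} [AddCommGroup M] [Module ℝ M] (c : ℝ) (z : Fin N → M) :
    mean (fun i => c • z i) = c • mean z := by
  simp only [mean, ← Finset.smul_sum]
  rw [smul_comm]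

lemma mean_const {M : Type*} [AddCommGroup M] [Module ℝ M] (hN : 1 ≤ N) (c : M) :
    mean (fun _ : Fin N => c) = c := by
  have : (N : ℝ) ≠ 0 := by positivity
  simp only [mean, Finset.sum_const, Finset.card_univ, Fintype.card_fin, ← Nat.cast_smul_eq_nsmul ℝ,
    smul_smul]
  rw [one_div, inv_mul_cancel₀ this, one_smul]

lemma map_mean (L : H →L[ℝ] H) (z : Fin N → H) : L (mean z) = mean (fun i => L (z i)) := by
  simp [mean]

lemma norm_mean_le (z : Fin N → H) : ‖mean z‖ ≤ mean (fun i => ‖z i‖) := by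
  simp only [mean, norm_smul, smul_eq_mul]
  rw [Real.norm_of_nonneg (by positivity)]
  gcongr
  exact norm_sum_le _ _

lemma mean_le_mean {z w : Fin N → ℝ} (h : ∀ i, z i ≤ w i) : mean z ≤ mean w := by
  simp only [mean, smul_eq_mul]
  gcongr
  exact h _

lemma mean_nonneg {z : Fin N → ℝ} (h : ∀ i, 0 ≤ z i) : 0 ≤ mean z := by
  simp only [mean, smul_eq_mul]
  have := Finset.sum_nonneg (fun i (_ : i ∈ Finset.univ) => h i)
  positivity

lemma inner_mean (w : H) (z : Fin N → H) :
    inner ℝ w (mean z) = mean (fun i => inner ℝ w (z i)) := by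
  simp [mean, inner_smul_right, inner_sum]

lemma mean_mem {W : Submodule ℝ H} {z : Fin N → H} (h : ∀ i, z i ∈ W) : mean z ∈ W :=
  W.smul_mem _ (W.sum_mem fun i _ => h i)

/-- The squared norm of an average of pairwise orthogonal vectors. -/
lemma norm_mean_sq_le {z : Fin N → H} (horth : ∀ i j, i ≠ j → inner ℝ (z i) (z j) = 0)
    (hN : 1 ≤ N) {c : ℝ} (hc : ∀ i, ‖z i‖ ^ 2 ≤ c) : ‖mean z‖ ^ 2 ≤ c / N := by
  have hN' : (0 : ℝ) < N := by positivity
  have h1 : ‖∑ i, z i‖ ^ 2 = ∑ i, ‖z i‖ ^ 2 := by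
    rw [← real_inner_self_eq_norm_sq, sum_inner]
    refine Finset.sum_congr rfl fun i _ => ?_
    rw [inner_sum, Finset.sum_eq_single i, real_inner_self_eq_norm_sq]
    · intro j _ hj
      exact horth i j hj.symm
    · simp
  have h2 : ∑ i, ‖z i‖ ^ 2 ≤ N * c := by
    calc _ ≤ ∑ _i : Fin N, c := Finset.sum_le_sum fun i _ => hc i
      _ = _ := by simp
  rw [mean, norm_smul, mul_pow, h1, Real.norm_of_nonneg (by positivity)]
  calc (1 / (N : ℝ)) ^ 2 * ∑ i, ‖z i‖ ^ 2 ≤ (1 / (N : ℝ)) ^ 2 * (N * c) := by gcongr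
    _ = c / N := by field_simp

/-- The norm of a symmetric operator equals its numerical radius, by polarisation; no spectral
theory or completeness enters. -/
lemma norm_apply_le_of_abs_inner_le {T : H →L[ℝ] H}
    (hT : ∀ x y, inner ℝ (T x) y = inner ℝ x (T y)) {c : ℝ}
    (hc : ∀ v, |inner ℝ v (T v)| ≤ c * ‖v‖ ^ 2) (v : H) : ‖T v‖ ≤ c * ‖v‖ := by
  by_cases hv : ‖v‖ = 0
  · have : v = 0 := by simpa using hv
    simp [this]
  by_cases hw : ‖T v‖ = 0
  · have h := hc v
    have : T v = 0 := by simpa using hw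
    have h0 : 0 ≤ c * ‖v‖ ^ 2 := (abs_nonneg _).trans h
    have hv' : 0 < ‖v‖ := lt_of_le_of_ne (norm_nonneg _) (Ne.symm hv)
    rw [hw]
    have : 0 ≤ c * ‖v‖ * ‖v‖ := by rwa [mul_assoc, ← sq]
    exact nonneg_of_mul_nonneg_left this hv'
  have hv' : 0 < ‖v‖ := lt_of_le_of_ne (norm_nonneg _) (Ne.symm hv)
  have hw' : 0 < ‖T v‖ := lt_of_le_of_ne (norm_nonneg _) (Ne.symm hw)
  -- This scaling makes `v` and `t • T v` equally long, which makes the parallelogram bound sharp.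
  set t : ℝ := ‖v‖ / ‖T v‖ with ht
  have h1 := (abs_le.1 (hc (v + t • T v))).2
  have h2 := (abs_le.1 (hc (v - t • T v))).1
  have hp : ‖v + t • T v‖ ^ 2 + ‖v - t • T v‖ ^ 2 = 2 * (‖v‖ ^ 2 + ‖t • T v‖ ^ 2) := by
    have := parallelogram_law_with_norm ℝ v (t • T v)
    nlinarith
  have hq : inner ℝ (v + t • T v) (T (v + t • T v)) - inner ℝ (v - t • T v) (T (v - t • T v))
      = 4 * t * ‖T v‖ ^ 2 := by
    simp only [map_add, map_sub, map_smul, inner_add_left, inner_add_right, inner_sub_left,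
      inner_sub_right, real_inner_smul_left, real_inner_smul_right]
    rw [← hT v (T v), real_inner_self_eq_norm_sq]
    ring
  have hn : ‖t • T v‖ = ‖v‖ := by
    rw [norm_smul, Real.norm_of_nonneg (by positivity), ht]
    field_simp
  rw [hn] at hp
  have h3 : 4 * t * ‖T v‖ ^ 2 ≤ c * (4 * ‖v‖ ^ 2) := by
    have := congrArg (c * ·) hp
    rw [← hq]; linarith
  have h4 : t * ‖T v‖ ^ 2 = ‖v‖ * ‖T v‖ := by rw [ht]; field_simp
  have h5 : ‖v‖ * ‖T v‖ ≤ ‖v‖ * (c * ‖v‖) := by nlinarith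
  exact le_of_mul_le_mul_left h5 hv'

/-- A gradient step on a quadratic with Hessian in `[-κ, β]` expands by at most `1 + η κ`. -/
lemma norm_sub_smul_apply_le {A : H →L[ℝ] H}
    (hA : ∀ x y, inner ℝ (A x) y = inner ℝ x (A y)) {β κ η : ℝ} (hη : 0 ≤ η) (hκ : 0 ≤ κ)
    (hβ : ∀ v, ‖A v‖ ≤ β * ‖v‖) (hlow : ∀ v, -κ * ‖v‖ ^ 2 ≤ inner ℝ v (A v)) (hηβ : η * β ≤ 1)
    (v : H) : ‖v - η • A v‖ ≤ (1 + η * κ) * ‖v‖ := by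
  have key := norm_apply_le_of_abs_inner_le (T := ContinuousLinearMap.id ℝ H - η • A)
    (c := 1 + η * κ) (fun x y => by
      simp [inner_sub_left, inner_sub_right, real_inner_smul_left, real_inner_smul_right, hA])
    (fun v => by
      simp only [sub_apply, ContinuousLinearMap.id_apply,
        smul_apply, inner_sub_right, real_inner_smul_right,
        real_inner_self_eq_norm_sq]
      have h1 := hlow v
      have h2 : inner ℝ v (A v) ≤ β * ‖v‖ ^ 2 := by
        calc _ ≤ ‖v‖ * ‖A v‖ := real_inner_le_norm _ _
          _ ≤ ‖v‖ * (β * ‖v‖) := by gcongr; exact hβ v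
          _ = _ := by ring
      have h3 : 0 ≤ (1 - η * β) * ‖v‖ ^ 2 := by
        have : 0 ≤ 1 - η * β := by linarith
        positivity
      have h4 := mul_le_mul_of_nonneg_left h1 hη
      have h5 := mul_le_mul_of_nonneg_left h2 hη
      have h6 : 0 ≤ η * κ * ‖v‖ ^ 2 := by positivity
      rw [abs_le]
      constructor <;> nlinarith [sq_nonneg ‖v‖])
  simpa using key v

end Hilbert

end

noncomputable section

/-! ### The noiseless local trajectories of a round. -/

section Drift

variable {H : Type*} [NormedAddCommGroup H] [InnerProductSpace ℝ H] {N : ℕ}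

lemma mean_apply (A : Fin N → H →L[ℝ] H) (v : H) : mean A v = mean (fun i => A i v) := by
  simp [mean]

lemma mean_symm_of_symm {A : Fin N → H →L[ℝ] H}
    (hA : ∀ i x y, inner ℝ (A i x) y = inner ℝ x (A i y)) (x y : H) :
    inner ℝ (mean A x) y = inner ℝ x (mean A y) := by
  rw [mean_apply, mean_apply, inner_mean, real_inner_comm, inner_mean]
  congr 1; funext i
  rw [real_inner_comm, hA]

/-- The displacement of the local models from the server model in a round without noise, where
`γ` is the gradient at the server model. -/
def drift (A : Fin N → H →L[ℝ] H) (η : ℝ) (γ : H) (i : Fin N) : ℕ → H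
  | 0 => 0
  | k + 1 => drift A η γ i k - η • (A i (drift A η γ i k) + γ)

/-- The power is at most `exp (a K)`, while `exp (-a K) ≥ 1 - 2 / 11 = 9 / 11`. -/
lemma one_add_pow_le {a : ℝ} (ha : 0 ≤ a) {k K : ℕ} (hk : k ≤ K) (h : 11 * (a * K) ≤ 2) :
    (1 + a) ^ k ≤ 11 / 9 := by
  have h1 : (1 + a) ^ k ≤ Real.exp (a * K) := by
    calc (1 + a) ^ k ≤ (1 + a) ^ K := pow_le_pow_right₀ (by linarith) hk
      _ ≤ Real.exp a ^ K := by gcongr; linarith [Real.add_one_le_exp a]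
      _ = _ := by rw [← Real.exp_nat_mul, mul_comm]
  have h2 := Real.add_one_le_exp (-(a * K))
  have h3 : Real.exp (a * K) * Real.exp (-(a * K)) = 1 := by rw [← Real.exp_add]; simp
  have h4 := Real.exp_pos (a * K)
  nlinarith

variable {A : Fin N → H →L[ℝ] H} {δ η : ℝ}

/-- Size of the mean displacement plus the client spread. -/
lemma norm_mean_drift_add_spread_le (hN : 1 ≤ N) (hη : 0 ≤ η) (hδ : 0 ≤ δ)
    (hc : ∀ v, ‖v - η • mean A v‖ ≤ (1 + η * δ) * ‖v‖)
    (hd : ∀ i v, ‖A i v - mean A v‖ ≤ δ * ‖v‖) (γ : H) (k : ℕ) :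
    ‖mean (fun i => drift A η γ i k)‖
        + mean (fun j => ‖drift A η γ j k - mean (fun i => drift A η γ i k)‖)
      ≤ (1 + 4 * (η * δ)) ^ k *
        (η * ∑ j ∈ Finset.range k, ‖γ + mean A (mean (fun i => drift A η γ i j))‖) := by
  induction k with
  | zero => simp [drift, mean]
  | succ k ih =>
    set v : Fin N → H := fun i => drift A η γ i k with hv
    set w : H := mean v with hw
    set e : H := mean (fun i => A i (v i) - mean A (v i)) with he
    set M : ℝ := mean (fun j => ‖v j - w‖) with hM
    have hM0 : 0 ≤ M := mean_nonneg fun j => norm_nonneg _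
    -- Writing `A i` as `mean A` plus the dissimilarity leaves only `δ` in the growth rate; the part
    -- with `mean A` is either a gradient or a nearly nonexpansive map.
    have hv1 : ∀ i, drift A η γ i (k + 1)
        = v i - η • mean A (v i) - η • γ - η • (A i (v i) - mean A (v i)) := by
      intro i
      simp only [drift, hv]
      module
    have hw1 : mean (fun i => drift A η γ i (k + 1)) = w - η • (γ + mean A w) - η • e := by
      simp_rw [hv1]
      rw [mean_sub, mean_sub, mean_sub, mean_smul, mean_smul, mean_smul, mean_const hN, hw, map_mean]
      module
    have hvi : ∀ i, ‖v i‖ ≤ ‖w‖ + ‖v i - w‖ := fun i => by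
      simpa using norm_add_le w (v i - w)
    have hBi : ∀ i, ‖A i (v i) - mean A (v i)‖ ≤ δ * (‖w‖ + ‖v i - w‖) := fun i =>
      (hd i _).trans (by gcongr; exact hvi i)
    have hmB : mean (fun i => δ * (‖w‖ + ‖v i - w‖)) = δ * (‖w‖ + M) := by
      have := mean_smul δ (fun i => ‖w‖ + ‖v i - w‖)
      simp only [smul_eq_mul] at this
      rw [this, mean_add, mean_const hN]
    have heB : ‖e‖ ≤ δ * (‖w‖ + M) := by
      rw [← hmB]
      exact (norm_mean_le _).trans (mean_le_mean hBi)
    have hV : ‖mean (fun i => drift A η γ i (k + 1))‖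
        ≤ ‖w‖ + η * ‖γ + mean A w‖ + η * (δ * (‖w‖ + M)) := by
      rw [hw1]
      refine (norm_sub_le _ _).trans (add_le_add ((norm_sub_le _ _).trans ?_) ?_)
      · rw [norm_smul, Real.norm_of_nonneg hη]
      · rw [norm_smul, Real.norm_of_nonneg hη]; gcongr
    have hS : mean (fun j => ‖drift A η γ j (k + 1) - mean (fun i => drift A η γ i (k + 1))‖)
        ≤ (1 + η * δ) * M + η * (δ * (‖w‖ + M)) + η * (δ * (‖w‖ + M)) := by
      have h1 : ∀ j, ‖drift A η γ j (k + 1) - mean (fun i => drift A η γ i (k + 1))‖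
          ≤ (1 + η * δ) * ‖v j - w‖ + η * (δ * (‖w‖ + ‖v j - w‖)) + η * (δ * (‖w‖ + M)) := by
        intro j
        have : drift A η γ j (k + 1) - mean (fun i => drift A η γ i (k + 1))
            = ((v j - w) - η • mean A (v j - w)) - η • (A j (v j) - mean A (v j)) + η • e := by
          rw [hw1, hv1, map_sub]; module
        rw [this]
        refine (norm_add_le _ _).trans (add_le_add ((norm_sub_le _ _).trans
          (add_le_add (hc _) ?_)) ?_)
        · rw [norm_smul, Real.norm_of_nonneg hη]; gcongr; exact hBi j
        · rw [norm_smul, Real.norm_of_nonneg hη]; gcongr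
      refine (mean_le_mean h1).trans (le_of_eq ?_)
      have h2 := mean_smul (1 + η * δ) (fun j => ‖v j - w‖)
      have h3 := mean_smul η (fun j => δ * (‖w‖ + ‖v j - w‖))
      simp only [smul_eq_mul] at h2 h3
      rw [mean_add, mean_add, h2, h3, hmB, mean_const hN]
    rw [Finset.sum_range_succ]
    set S := ∑ j ∈ Finset.range k, ‖γ + mean A (mean (fun i => drift A η γ i j))‖ with hSd
    have hηδ : 0 ≤ η * δ := by positivity
    have hρ : (1 : ℝ) ≤ (1 + 4 * (η * δ)) ^ (k + 1) := one_le_pow₀ (by linarith)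
    have h1 : (1 + 4 * (η * δ)) * (‖w‖ + M) ≤ (1 + 4 * (η * δ)) ^ (k + 1) * (η * S) := by
      calc _ ≤ (1 + 4 * (η * δ)) * ((1 + 4 * (η * δ)) ^ k * (η * S)) := by gcongr
        _ = _ := by ring
    have h2 : η * ‖γ + mean A w‖ ≤ (1 + 4 * (η * δ)) ^ (k + 1) * (η * ‖γ + mean A w‖) :=
      le_mul_of_one_le_left (by positivity) hρ
    have h3 : 0 ≤ η * δ * ‖w‖ := by positivity
    calc _ ≤ _ := add_le_add hV hS
      -- Of the four multiples of `η δ`, one comes from the mean displacement and three from the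
      -- spread: the expansion of `1 - η mean A`, the error of the single client and the averaged
      -- error.
      _ ≤ (1 + 4 * (η * δ)) * (‖w‖ + M) + η * ‖γ + mean A w‖ := by nlinarith
      _ ≤ _ := (add_le_add h1 h2).trans (le_of_eq (by ring))

/-- The dissimilarity error along the noiseless local trajectories is dominated by the gradients
along the averaged trajectory. -/
lemma sum_norm_mean_dissimilarity_drift_sq_le (hN : 1 ≤ N) (hη : 0 ≤ η) (hδ : 0 ≤ δ)
    (hc : ∀ v, ‖v - η • mean A v‖ ≤ (1 + η * δ) * ‖v‖)
    (hd : ∀ i v, ‖A i v - mean A v‖ ≤ δ * ‖v‖) {K : ℕ} (hK : 22 * δ * K * η ≤ 1) (γ : H) :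
    ∑ k ∈ Finset.range K,
        ‖mean (fun i => A i (drift A η γ i k) - mean A (drift A η γ i k))‖ ^ 2
      ≤ 1 / 300 * ∑ k ∈ Finset.range K, ‖γ + mean A (mean (fun i => drift A η γ i k))‖ ^ 2 := by
  set g : ℕ → ℝ := fun k => ‖γ + mean A (mean (fun i => drift A η γ i k))‖ with hg
  have hηδ : 0 ≤ η * δ := by positivity
  have key : ∀ k ∈ Finset.range K,
      ‖mean (fun i => A i (drift A η γ i k) - mean A (drift A η γ i k))‖ ^ 2
        ≤ (δ * (11 / 9 * η)) ^ 2 * (K * ∑ j ∈ Finset.range K, g j ^ 2) := by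
    intro k hk
    have hkK : k ≤ K := (Finset.mem_range.1 hk).le
    set v : Fin N → H := fun i => drift A η γ i k with hv
    have h1 : ‖mean (fun i => A i (v i) - mean A (v i))‖
        ≤ δ * (‖mean v‖ + mean (fun j => ‖v j - mean v‖)) := by
      refine (norm_mean_le _).trans ?_
      have := mean_smul δ (fun i => ‖mean v‖ + ‖v i - mean v‖)
      rw [mean_add, mean_const hN] at this
      simp only [smul_eq_mul] at this
      rw [← this]
      refine mean_le_mean fun i => (hd i _).trans ?_
      gcongr
      simpa using norm_add_le (mean v) (v i - mean v)
    have h2 := norm_mean_drift_add_spread_le hN hη hδ hc hd γ k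
    have hS0 : 0 ≤ ∑ j ∈ Finset.range k, g j := Finset.sum_nonneg fun _ _ => norm_nonneg _
    have h3 : (1 + 4 * (η * δ)) ^ k ≤ 11 / 9 := one_add_pow_le (by positivity) hkK (by linarith)
    have h4 : ‖mean (fun i => A i (v i) - mean A (v i))‖
        ≤ δ * (11 / 9 * η) * ∑ j ∈ Finset.range k, g j := by
      refine h1.trans ?_
      rw [mul_assoc, mul_assoc]
      refine mul_le_mul_of_nonneg_left (h2.trans ?_) hδ
      gcongr
    calc _ ≤ (δ * (11 / 9 * η) * ∑ j ∈ Finset.range k, g j) ^ 2 := by gcongr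
      _ = (δ * (11 / 9 * η)) ^ 2 * (∑ j ∈ Finset.range k, g j) ^ 2 := by ring
      _ ≤ _ := by
        gcongr
        have := sq_sum_le_card_mul_sum_sq (s := Finset.range k) (f := g)
        rw [Finset.card_range] at this
        refine this.trans ?_
        have : ∑ j ∈ Finset.range k, g j ^ 2 ≤ ∑ j ∈ Finset.range K, g j ^ 2 :=
          Finset.sum_le_sum_of_subset_of_nonneg (Finset.range_mono hkK) fun _ _ _ => sq_nonneg _
        gcongr
  refine (Finset.sum_le_sum key).trans ?_
  rw [Finset.sum_const, Finset.card_range, nsmul_eq_mul]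
  have hG : 0 ≤ ∑ j ∈ Finset.range K, g j ^ 2 := Finset.sum_nonneg fun _ _ => sq_nonneg _
  have h5 : (δ * K * η) ^ 2 ≤ (1 / 22) ^ 2 := by
    have : 0 ≤ δ * K * η := by positivity
    gcongr
    linarith
  -- Numerically `(11 / 9)² (1 / 22)² = 1 / 324`.
  calc _ = (121 / 81 * (δ * K * η) ^ 2) * ∑ j ∈ Finset.range K, g j ^ 2 := by ring
    _ ≤ _ := by gcongr; linarith

end Drift

end

noncomputable section

/-! ### One round with noise, in an abstract Hilbert space. -/

section Round

variable {H : Type*} [NormedAddCommGroup H] [InnerProductSpace ℝ H] {N : ℕ}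

/-- The quadratic function with Hessian `A` and linear part `b`. -/
def quadForm (A : H →L[ℝ] H) (b z : H) : ℝ := 1 / 2 * inner ℝ z (A z) + inner ℝ b z

lemma exp_le_one_add {x : ℝ} (hx0 : 0 ≤ x) (hx1 : x ≤ 1 / 10) :
    Real.exp (x / 2) ≤ 1 + 3 / 5 * x := by
  have e1 := Real.add_one_le_exp (-(x / 2))
  have e2 : Real.exp (x / 2) * Real.exp (-(x / 2)) = 1 := by rw [← Real.exp_add]; simp
  have e4 := mul_le_mul_of_nonneg_left e1 (Real.exp_pos (x / 2)).le
  rw [e2] at e4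
  nlinarith

/-- The descent error is controlled only by the sum of `g` over the whole round, so a stepwise
contraction is not available. Instead the final gap is compared with the gap at each step `k`, hence
with `g k / (2 μ)`; summing over `k` bounds `μ η K` times the final gap by about half of `η ∑ g`,
which the decrease from step `0` pays for. -/
lemma gap_contraction_of_descent {φ g : ℕ → ℝ} {K : ℕ} {μ η τ m : ℝ} (hμ : 0 < μ) (hη : 0 < η)
    (hτ0 : 0 ≤ τ) (hstep : 10 * μ * K * η ≤ 1) (hg : ∀ k, 0 ≤ g k)
    (hPL : ∀ k, 2 * μ * (φ k - m) ≤ g k) (hm : m ≤ φ K)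
    (hdesc : ∀ k ≤ K, φ K ≤ φ k - 17 / 20 * η * ∑ j ∈ Finset.Ico k K, g j
      + 1 / 20 * η * ∑ j ∈ Finset.range K, g j + 2 * K * (η * τ)) :
    Real.exp (μ * η * K / 2) * (φ K - m) + 2 / 5 * η * ∑ j ∈ Finset.range K, g j
      ≤ φ 0 - m + 3 * K * (η * τ) := by
  have ha0 : 0 ≤ φ K - m := by linarith
  have hG0 : 0 ≤ ∑ j ∈ Finset.range K, g j := Finset.sum_nonneg fun _ _ => hg _
  have h1 : ∀ k ∈ Finset.range K, φ K - m ≤ 1 / (2 * μ) * g k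
      + (1 / 20 * η * (∑ j ∈ Finset.range K, g j) + 2 * K * (η * τ)) := by
    intro k hk
    have h2 := hdesc k (Finset.mem_range.1 hk).le
    have h5 : 0 ≤ 17 / 20 * η * ∑ j ∈ Finset.Ico k K, g j :=
      mul_nonneg (by positivity) (Finset.sum_nonneg fun _ _ => hg _)
    have h6 : φ k - m ≤ 1 / (2 * μ) * g k := by
      rw [div_mul_eq_mul_div, one_mul, le_div_iff₀ (by positivity)]; linarith [hPL k]
    linarith
  have h2 := Finset.sum_le_sum h1
  have h9 := hdesc 0 (Nat.zero_le K)
  rw [Finset.sum_add_distrib, ← Finset.mul_sum, Finset.sum_const, Finset.sum_const,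
    Finset.card_range, nsmul_eq_mul, nsmul_eq_mul] at h2
  rw [Nat.Ico_zero_eq_range] at h9
  generalize ∑ j ∈ Finset.range K, g j = G at *
  generalize ha : φ K - m = a at *
  have hx0 : 0 ≤ μ * η * K := by positivity
  have hx1 : μ * η * K ≤ 1 / 10 := by linarith
  have h10 : 0 ≤ K * (η * τ) := by positivity
  have h11 : 0 ≤ η * G := by positivity
  have h3 : μ * η * K * a ≤ 51 / 100 * (η * G) + 1 / 5 * (K * (η * τ)) := by
    have h4 := mul_le_mul_of_nonneg_left h2 (by positivity : 0 ≤ μ * η)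
    have h5 : μ * η * (1 / (2 * μ) * G) = 1 / 2 * (η * G) := by field_simp
    have h6 : μ * η * K * (η * G) ≤ 1 / 10 * (η * G) :=
      mul_le_mul_of_nonneg_right hx1 (by positivity)
    have h7 : μ * η * K * (K * (η * τ)) ≤ 1 / 10 * (K * (η * τ)) :=
      mul_le_mul_of_nonneg_right hx1 (by positivity)
    linarith
  have hexp := exp_le_one_add hx0 hx1
  have h8 := mul_le_mul_of_nonneg_right hexp ha0
  linarith

/-- One round of local steps on quadratic client functions with Hessians `A i` in a Hilbert space
of square-integrable random vectors. The average objective has linear part `b`, the round starts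
at `x`, and `W i k` consists of random vectors that do not depend on the sample behind the
gradient noise `ξ i k`. -/
structure IsRound (A : Fin N → H →L[ℝ] H) (b x : H) (y ξ : Fin N → ℕ → H)
    (W : Fin N → ℕ → Submodule ℝ H) (K : ℕ) (β δ σ η : ℝ) : Prop where
  one_le : 1 ≤ N
  η_pos : 0 < η
  δ_nonneg : 0 ≤ δ
  β_pos : 0 < β
  step_β : 10 * β * η ≤ 1
  step_δ : 22 * δ * K * η ≤ 1
  symm : ∀ i v w, inner ℝ (A i v) w = inner ℝ v (A i w)
  norm_le : ∀ i v, ‖A i v‖ ≤ β * ‖v‖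
  dissim : ∀ i v, ‖A i v - mean A v‖ ≤ δ * ‖v‖
  lower : ∀ v, -δ * ‖v‖ ^ 2 ≤ inner ℝ v (mean A v)
  init : ∀ i, y i 0 = x
  step : ∀ i, ∀ k < K, y i (k + 1) = y i k - η • (A i (y i k - x) + (mean A x + b) + ξ i k)
  apply_mem : ∀ i k j, ∀ v ∈ W i k, A j v ∈ W i k
  init_mem : ∀ i, ∀ k < K, x ∈ W i k
  const_mem : ∀ i, ∀ k < K, b ∈ W i k
  -- Later noise of the same client is left out: it is evaluated at a model that depends on the
  -- sample of step `k`.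
  noise_mem : ∀ i, ∀ k < K, ∀ j, ∀ l < K, (j ≠ i ∨ l < k) → ξ j l ∈ W i k
  orth : ∀ i, ∀ k < K, ∀ v ∈ W i k, inner ℝ v (ξ i k) = 0
  noise_le : ∀ i, ∀ k < K, ‖ξ i k‖ ^ 2 ≤ σ ^ 2

namespace IsRound

variable {A : Fin N → H →L[ℝ] H} {b x : H} {y ξ : Fin N → ℕ → H}
  {W : Fin N → ℕ → Submodule ℝ H} {K : ℕ} {β δ σ η : ℝ}

lemma mean_symm (h : IsRound A b x y ξ W K β δ σ η) (v w : H) :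
    inner ℝ (mean A v) w = inner ℝ v (mean A w) :=
  mean_symm_of_symm h.symm v w

lemma norm_mean_apply_le (h : IsRound A b x y ξ W K β δ σ η) (v : H) :
    ‖mean A v‖ ≤ β * ‖v‖ := by
  rw [mean_apply]
  refine (norm_mean_le _).trans ((mean_le_mean fun i => h.norm_le i v).trans ?_)
  rw [mean_const h.one_le]

/-- Mixing the bounds `δ` and `2 β`, rather than squaring `δ`, lets one factor `δ` pair with `K η`
and the other factor become the `β` of the noise term. -/
lemma dissim_sq_le (h : IsRound A b x y ξ W K β δ σ η) (i : Fin N) (v : H) :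
    ‖A i v - mean A v‖ ^ 2 ≤ 2 * β * δ * ‖v‖ ^ 2 := by
  have h1 := h.dissim i v
  have h2 : ‖A i v - mean A v‖ ≤ 2 * β * ‖v‖ := by
    linarith [norm_sub_le (A i v) (mean A v), h.norm_le i v, h.norm_mean_apply_le v]
  have := mul_le_mul h1 h2 (norm_nonneg _) (by have := h.δ_nonneg; positivity)
  calc _ = ‖A i v - mean A v‖ * ‖A i v - mean A v‖ := sq _
    _ ≤ _ := this
    _ = _ := by ring

lemma neg_two_mul_le (h : IsRound A b x y ξ W K β δ σ η) (i : Fin N) (v : H) :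
    -(2 * δ) * ‖v‖ ^ 2 ≤ inner ℝ v (A i v) := by
  have h1 : |inner ℝ v (A i v - mean A v)| ≤ ‖v‖ * (δ * ‖v‖) :=
    (abs_real_inner_le_norm _ _).trans (by gcongr; exact h.dissim i v)
  have h2 := (abs_le.1 h1).1
  rw [inner_sub_right] at h2
  linarith [h.lower v, (by ring : ‖v‖ * (δ * ‖v‖) = δ * ‖v‖ ^ 2)]

lemma contraction_mean (h : IsRound A b x y ξ W K β δ σ η) (v : H) :
    ‖v - η • mean A v‖ ≤ (1 + η * δ) * ‖v‖ :=
  norm_sub_smul_apply_le h.mean_symm h.η_pos.le h.δ_nonneg h.norm_mean_apply_le h.lower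
    (by nlinarith [h.step_β, h.η_pos, h.β_pos, mul_pos h.η_pos h.β_pos]) v

lemma contraction (h : IsRound A b x y ξ W K β δ σ η) (i : Fin N) (v : H) :
    ‖v - η • A i v‖ ≤ (1 + η * (2 * δ)) * ‖v‖ :=
  norm_sub_smul_apply_le (h.symm i) h.η_pos.le (by linarith [h.δ_nonneg]) (h.norm_le i)
    (h.neg_two_mul_le i)
    (by nlinarith [h.step_β, h.η_pos, h.β_pos, mul_pos h.η_pos h.β_pos]) v

lemma mean_apply_mem (h : IsRound A b x y ξ W K β δ σ η) {i : Fin N} {k : ℕ} {v : H}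
    (hv : v ∈ W i k) : mean A v ∈ W i k := by
  rw [mean_apply]
  exact mean_mem fun j => h.apply_mem i k j v hv

lemma drift_mem (h : IsRound A b x y ξ W K β δ σ η) {i : Fin N} {k : ℕ} (hk : k < K) (j : Fin N)
    (l : ℕ) : drift A η (mean A x + b) j l ∈ W i k := by
  induction l with
  | zero => simp [drift]
  | succ l ih =>
    exact (W i k).sub_mem ih ((W i k).smul_mem _ ((W i k).add_mem (h.apply_mem i k j _ ih)
      ((W i k).add_mem (h.mean_apply_mem (h.init_mem i k hk)) (h.const_mem i k hk))))

variable (A b x y η) in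
/-- The part of a local model that is due to the noise of the round. -/
def noisePart (i : Fin N) (k : ℕ) : H := y i k - x - drift A η (mean A x + b) i k

lemma noisePart_zero (h : IsRound A b x y ξ W K β δ σ η) (i : Fin N) :
    noisePart A b x y η i 0 = 0 := by
  simp [noisePart, drift, h.init]

/-- Here the quadratic form of the clients is essential: the gradient at the server model cancels
between two affine recursions with the same linear part, leaving a linear recursion driven by noise
alone. -/
lemma noisePart_succ (h : IsRound A b x y ξ W K β δ σ η) (i : Fin N) {k : ℕ} (hk : k < K) :
    noisePart A b x y η i (k + 1) = (noisePart A b x y η i k - η • A i (noisePart A b x y η i k))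
      - η • ξ i k := by
  simp only [noisePart, drift, h.step i k hk, map_sub]
  module

lemma noisePart_mem (h : IsRound A b x y ξ W K β δ σ η) {i : Fin N} {k : ℕ} (hk : k < K)
    (j : Fin N) {l : ℕ} (hl : l ≤ K) (hjl : j ≠ i ∨ l ≤ k) :
    noisePart A b x y η j l ∈ W i k := by
  induction l with
  | zero => simp [h.noisePart_zero]
  | succ l ih =>
    have h1 := ih (by omega) (by omega)
    rw [h.noisePart_succ j (by omega)]
    exact (W i k).sub_mem ((W i k).sub_mem h1 ((W i k).smul_mem _ (h.apply_mem i k j _ h1)))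
      ((W i k).smul_mem _ (h.noise_mem i k hk j l (by omega) (by omega)))

lemma local_mem (h : IsRound A b x y ξ W K β δ σ η) {i : Fin N} {k : ℕ} (hk : k < K)
    (j : Fin N) : y j k ∈ W i k := by
  have : y j k = noisePart A b x y η j k + x + drift A η (mean A x + b) j k := by
    rw [noisePart]; abel
  rw [this]
  exact (W i k).add_mem ((W i k).add_mem (h.noisePart_mem hk j hk.le (Or.inr le_rfl))
    (h.init_mem i k hk)) (h.drift_mem hk j k)

/-- The noise part is a sum of operators applied to the noise of client `i`. Symmetry moves the
operators onto `v`, which stays in the subspaces `W i l`, so the induction must run over all such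
`v`. -/
lemma inner_noisePart_eq_zero (h : IsRound A b x y ξ W K β δ σ η) (i : Fin N) {k : ℕ}
    (hk : k ≤ K) {v : H} (hv : ∀ l < K, v ∈ W i l) :
    inner ℝ (noisePart A b x y η i k) v = 0 := by
  induction k generalizing v with
  | zero => simp [h.noisePart_zero]
  | succ k ih =>
    have h1 := ih (by omega) hv
    have h2 := ih (by omega) (fun l hl => h.apply_mem i l i v (hv l hl))
    have h3 := h.orth i k (by omega) v (hv k (by omega))
    rw [real_inner_comm] at h3
    rw [h.noisePart_succ i (by omega), inner_sub_left, inner_sub_left, real_inner_smul_left,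
      real_inner_smul_left, h.symm, h1, h2, h3]
    simp

/-- Each fresh noise vector is orthogonal to the propagated old part, so squared norms add;
propagation expands by at most `1 + 2 η δ` per step. The constant comes from `(11 / 9)² ≤ 3 / 2`. -/
lemma norm_noisePart_sq_le (h : IsRound A b x y ξ W K β δ σ η) (i : Fin N) {k : ℕ}
    (hk : k ≤ K) : ‖noisePart A b x y η i k‖ ^ 2 ≤ 3 / 2 * (K * (η ^ 2 * σ ^ 2)) := by
  have hηδ : 0 ≤ η * (2 * δ) := by have := h.η_pos; have := h.δ_nonneg; positivity
  have key : ∀ k ≤ K, ‖noisePart A b x y η i k‖ ^ 2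
      ≤ ((1 + η * (2 * δ)) ^ k) ^ 2 * (k * (η ^ 2 * σ ^ 2)) := by
    intro k hk
    induction k with
    | zero => simp [h.noisePart_zero]
    | succ k ih =>
      have h0 := ih (by omega)
      set n := noisePart A b x y η i k
      have hn : n ∈ W i k := h.noisePart_mem (by omega) i (by omega) (Or.inr le_rfl)
      have horth : inner ℝ (n - η • A i n) (ξ i k) = 0 :=
        h.orth i k (by omega) _ ((W i k).sub_mem hn ((W i k).smul_mem _ (h.apply_mem i k i _ hn)))
      rw [h.noisePart_succ i (by omega), norm_sub_sq_real, real_inner_smul_right, horth,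
        norm_smul, mul_pow, Real.norm_eq_abs, sq_abs]
      have h1 : ‖n - η • A i n‖ ^ 2 ≤ (1 + η * (2 * δ)) ^ 2 * ‖n‖ ^ 2 := by
        rw [← mul_pow]; gcongr; exact h.contraction i n
      have h2 := h.noise_le i k (by omega)
      have h3 : (1 : ℝ) ≤ ((1 + η * (2 * δ)) ^ (k + 1)) ^ 2 :=
        one_le_pow₀ (one_le_pow₀ (by linarith))
      have h4 : (1 + η * (2 * δ)) ^ 2 * ‖n‖ ^ 2
          ≤ ((1 + η * (2 * δ)) ^ (k + 1)) ^ 2 * (k * (η ^ 2 * σ ^ 2)) := by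
        calc _ ≤ (1 + η * (2 * δ)) ^ 2 * (((1 + η * (2 * δ)) ^ k) ^ 2 * (k * (η ^ 2 * σ ^ 2))) := by
              gcongr
          _ = _ := by ring
      have h5 : η ^ 2 * ‖ξ i k‖ ^ 2 ≤ ((1 + η * (2 * δ)) ^ (k + 1)) ^ 2 * (η ^ 2 * σ ^ 2) := by
        calc _ ≤ η ^ 2 * σ ^ 2 := by gcongr
          _ ≤ _ := le_mul_of_one_le_left (by positivity) h3
      push_cast
      linarith
  refine (key k hk).trans ?_
  have h1 : (1 + η * (2 * δ)) ^ k ≤ 11 / 9 := one_add_pow_le hηδ hk (by linarith [h.step_δ])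
  have h2 : ((1 + η * (2 * δ)) ^ k) ^ 2 ≤ (11 / 9) ^ 2 := by gcongr
  have h3 : (k : ℝ) ≤ K := by exact_mod_cast hk
  gcongr
  linarith

/-- The error of the averaged local gradients with respect to the gradient at the averaged
model. -/
def dissimilarityError (A : Fin N → H →L[ℝ] H) (x : H) (y : Fin N → ℕ → H) (k : ℕ) : H :=
  mean (fun i => A i (y i k - x) - mean A (y i k - x))

lemma norm_mean_dissimilarity_noisePart_sq_le (h : IsRound A b x y ξ W K β δ σ η) {k : ℕ}
    (hk : k ≤ K) :
    ‖mean (fun i => A i (noisePart A b x y η i k) - mean A (noisePart A b x y η i k))‖ ^ 2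
      ≤ 3 / 22 * (η * β * σ ^ 2 / N) := by
  have hN : (0 : ℝ) < N := by have := h.one_le; positivity
  have hη := h.η_pos
  have hβ := h.β_pos
  have hδ := h.δ_nonneg
  refine (norm_mean_sq_le (c := 3 / 22 * (η * β * σ ^ 2)) ?_ h.one_le fun i => ?_).trans
    (le_of_eq (by ring))
  · intro i j hij
    -- The noise of one client does not involve the samples of another, so the cross terms between
    -- clients vanish even after applying their Hessians.
    have hmem : ∀ l < K, noisePart A b x y η j k ∈ W i l := fun l hl =>
      h.noisePart_mem hl j hk (Or.inl hij.symm)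
    have hB : ∀ l < K, ∀ v ∈ W i l, ∀ j', A j' v - mean A v ∈ W i l := fun l _ v hv j' =>
      (W i l).sub_mem (h.apply_mem i l j' v hv) (h.mean_apply_mem hv)
    rw [inner_sub_left, h.symm, h.mean_symm, ← inner_sub_right]
    exact h.inner_noisePart_eq_zero i hk fun l hl => hB l hl _ (hB l hl _ (hmem l hl) j) i
  · have h1 := h.dissim_sq_le i (noisePart A b x y η i k)
    have h2 := h.norm_noisePart_sq_le i hk
    calc _ ≤ 2 * β * δ * ‖noisePart A b x y η i k‖ ^ 2 := h1
      _ ≤ 2 * β * δ * (3 / 2 * (K * (η ^ 2 * σ ^ 2))) := by gcongr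
      _ = 3 * β * η * σ ^ 2 * (δ * K * η) := by ring
      _ ≤ 3 * β * η * σ ^ 2 * (1 / 22) := by gcongr; linarith [h.step_δ]
      _ = _ := by ring

lemma mean_local_eq (h : IsRound A b x y ξ W K β δ σ η) (k : ℕ) :
    mean (fun i => y i k) = x + mean (fun i => drift A η (mean A x + b) i k)
      + mean (fun i => noisePart A b x y η i k) := by
  have : (fun i => y i k)
      = fun i => x + drift A η (mean A x + b) i k + noisePart A b x y η i k := by
    funext i; simp [noisePart]
  rw [this, mean_add, mean_add, mean_const h.one_le]

/-- The gradient at the averaged model is the noiseless gradient plus `mean A` of the averaged noise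
part, and the two are orthogonal: in mean square, noise only increases the gradient. -/
lemma norm_grad_drift_sq_le (h : IsRound A b x y ξ W K β δ σ η) {k : ℕ} (hk : k ≤ K) :
    ‖(mean A x + b) + mean A (mean (fun i => drift A η (mean A x + b) i k))‖ ^ 2
      ≤ ‖mean A (mean (fun i => y i k)) + b‖ ^ 2 := by
  set v := mean (fun i => drift A η (mean A x + b) i k) with hv
  set n := mean (fun i => noisePart A b x y η i k) with hn
  have h1 : mean A (mean (fun i => y i k)) + b = ((mean A x + b) + mean A v) + mean A n := by
    rw [h.mean_local_eq, map_add, map_add]; abel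
  have h2 : inner ℝ ((mean A x + b) + mean A v) (mean A n) = 0 := by
    rw [← h.mean_symm, hn, inner_mean]
    have : ∀ i, inner ℝ (mean A ((mean A x + b) + mean A v)) (noisePart A b x y η i k) = 0 := by
      intro i
      rw [real_inner_comm]
      refine h.inner_noisePart_eq_zero i hk fun l hl => h.mean_apply_mem ((W i l).add_mem
        ((W i l).add_mem (h.mean_apply_mem (h.init_mem i l hl)) (h.const_mem i l hl))
        (h.mean_apply_mem (mean_mem fun j => h.drift_mem hl j k)))
    simp_rw [this]
    simp [mean]
  rw [h1, norm_add_sq_real (mean A x + b + mean A v), h2]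
  nlinarith [sq_nonneg ‖mean A n‖]

/-- The constants are twice `1 / 300` and twice `3 / 22`, from splitting the error into drift and
noise parts. -/
lemma sum_norm_dissimilarityError_sq_le (h : IsRound A b x y ξ W K β δ σ η) :
    ∑ k ∈ Finset.range K, ‖dissimilarityError A x y k‖ ^ 2
      ≤ 1 / 150 * ∑ k ∈ Finset.range K, ‖mean A (mean (fun i => y i k)) + b‖ ^ 2
        + K * (3 / 11 * (η * β * σ ^ 2 / N)) := by
  set γ := mean A x + b
  have h1 : ∀ k ∈ Finset.range K, ‖dissimilarityError A x y k‖ ^ 2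
      ≤ 2 * ‖mean (fun i => A i (drift A η γ i k) - mean A (drift A η γ i k))‖ ^ 2
        + 3 / 11 * (η * β * σ ^ 2 / N) := by
    intro k hk
    have h2 := h.norm_mean_dissimilarity_noisePart_sq_le (Finset.mem_range.1 hk).le
    set u := mean (fun i => A i (drift A η γ i k) - mean A (drift A η γ i k))
    set w := mean (fun i => A i (noisePart A b x y η i k) - mean A (noisePart A b x y η i k))
      with hw
    have h3 : dissimilarityError A x y k = u + w := by
      rw [← mean_add, dissimilarityError]
      congr 1; funext i
      simp only [noisePart, map_sub]; abel
    have h4 : ‖u + w‖ ^ 2 ≤ 2 * ‖u‖ ^ 2 + 2 * ‖w‖ ^ 2 := by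
      have := norm_add_le u w
      have := pow_le_pow_left₀ (norm_nonneg _) this 2
      nlinarith [sq_nonneg (‖u‖ - ‖w‖)]
    rw [h3]
    linarith
  have h5 := sum_norm_mean_dissimilarity_drift_sq_le h.one_le h.η_pos.le h.δ_nonneg
    h.contraction_mean h.dissim h.step_δ γ
  have h6 : ∑ k ∈ Finset.range K, ‖γ + mean A (mean (fun i => drift A η γ i k))‖ ^ 2
      ≤ ∑ k ∈ Finset.range K, ‖mean A (mean (fun i => y i k)) + b‖ ^ 2 :=
    Finset.sum_le_sum fun k hk => h.norm_grad_drift_sq_le (Finset.mem_range.1 hk).le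
  refine (Finset.sum_le_sum h1).trans ?_
  rw [Finset.sum_add_distrib, ← Finset.mul_sum, Finset.sum_const, Finset.card_range, nsmul_eq_mul]
  linarith

lemma mean_local_succ (h : IsRound A b x y ξ W K β δ σ η) {k : ℕ} (hk : k < K) :
    mean (fun i => y i (k + 1)) = mean (fun i => y i k)
      - η • ((mean A (mean (fun i => y i k)) + b) + dissimilarityError A x y k
        + mean (fun i => ξ i k)) := by
  simp_rw [h.step _ k hk]
  rw [mean_sub, mean_smul, mean_add, mean_add, mean_const h.one_le, dissimilarityError, mean_sub,
    ← map_mean, mean_sub, mean_const h.one_le, map_sub]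
  module

lemma inner_mean_noise_eq_zero (h : IsRound A b x y ξ W K β δ σ η) {k : ℕ} (hk : k < K) {v : H}
    (hv : ∀ i, v ∈ W i k) : inner ℝ v (mean (fun i => ξ i k)) = 0 := by
  rw [inner_mean]
  simp [h.orth _ k hk v (hv _), mean]

lemma norm_mean_noise_sq_le (h : IsRound A b x y ξ W K β δ σ η) {k : ℕ} (hk : k < K) :
    ‖mean (fun i => ξ i k)‖ ^ 2 ≤ σ ^ 2 / N :=
  norm_mean_sq_le (fun i j hij => h.orth j k hk _ (h.noise_mem j k hk i k hk (Or.inl hij)))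
    h.one_le fun i => h.noise_le i k hk

lemma quadForm_sub_smul (h : IsRound A b x y ξ W K β δ σ η) (z w : H) :
    quadForm (mean A) b (z - η • w) ≤ quadForm (mean A) b z
      - η * inner ℝ (mean A z + b) w + η ^ 2 * β / 2 * ‖w‖ ^ 2 := by
  have h1 : inner ℝ w (mean A w) ≤ β * ‖w‖ ^ 2 := by
    calc _ ≤ ‖w‖ * ‖mean A w‖ := real_inner_le_norm _ _
      _ ≤ ‖w‖ * (β * ‖w‖) := by gcongr; exact h.norm_mean_apply_le w
      _ = _ := by ring
  have h2 : quadForm (mean A) b (z - η • w) = quadForm (mean A) b z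
      - η * inner ℝ (mean A z + b) w + η ^ 2 / 2 * inner ℝ w (mean A w) := by
    simp only [quadForm, map_sub, map_smul, inner_sub_left, inner_sub_right, inner_add_left,
      real_inner_smul_left, real_inner_smul_right, ← h.mean_symm z w]
    rw [real_inner_comm w (mean A z)]
    ring
  rw [h2]
  have := mul_le_mul_of_nonneg_left h1 (by positivity : 0 ≤ η ^ 2 / 2)
  linarith

/-- The current models are free of the fresh noise, so the cross terms with the noise vanish. In the
first bound `17 / 20 = 1 - 1 / 20 - 1 / 10`: Young's inequality against the error, and the
second-order term with `η β ≤ 1 / 10`. The second bound moves the gradient estimate forward by one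
step. -/
lemma step_descent (h : IsRound A b x y ξ W K β δ σ η) {k : ℕ} (hk : k < K) :
    quadForm (mean A) b (mean (fun i => y i (k + 1)))
        ≤ quadForm (mean A) b (mean (fun i => y i k))
          - 17 / 20 * η * ‖mean A (mean (fun i => y i k)) + b‖ ^ 2
          + 51 / 10 * η * ‖dissimilarityError A x y k‖ ^ 2 + η * (η * β * σ ^ 2 / N) / 2 ∧
      ‖mean A (mean (fun i => y i (k + 1))) + b‖ ^ 2
        ≤ 41 / 20 * ‖mean A (mean (fun i => y i k)) + b‖ ^ 2
          + 1 / 20 * ‖dissimilarityError A x y k‖ ^ 2 + 1 / 5 * (η * β * σ ^ 2 / N) := by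
  have hη := h.η_pos
  have hβ := h.β_pos
  have hN : (0 : ℝ) < N := by have := h.one_le; positivity
  set z := mean (fun i => y i k) with hz
  set g := mean A z + b with hg
  set e := dissimilarityError A x y k with he
  set w := mean (fun i => ξ i k) with hw
  have hzm : ∀ i, z ∈ W i k := fun i => mean_mem fun j => h.local_mem hk j
  have hgm : ∀ i, g ∈ W i k := fun i =>
    (W i k).add_mem (h.mean_apply_mem (hzm i)) (h.const_mem i k hk)
  have hem : ∀ i, e ∈ W i k := fun i => mean_mem fun j =>
    have h1 := (W i k).sub_mem (h.local_mem hk j) (h.init_mem i k hk)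
    (W i k).sub_mem (h.apply_mem i k j _ h1) (h.mean_apply_mem h1)
  have hgw := h.inner_mean_noise_eq_zero hk hgm
  have hew := h.inner_mean_noise_eq_zero hk hem
  have hwσ := h.norm_mean_noise_sq_le hk
  rw [← hw] at hgw hew hwσ
  have hnorm : ‖g + e + w‖ ^ 2 = ‖g + e‖ ^ 2 + ‖w‖ ^ 2 := by
    rw [norm_add_sq_real, inner_add_left, hgw, hew]; ring
  have hge : ‖g + e‖ ^ 2 ≤ 2 * ‖g‖ ^ 2 + 2 * ‖e‖ ^ 2 := by
    have := pow_le_pow_left₀ (norm_nonneg _) (norm_add_le g e) 2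
    nlinarith [sq_nonneg (‖g‖ - ‖e‖)]
  have hinner : -inner ℝ g e ≤ 1 / 20 * ‖g‖ ^ 2 + 5 * ‖e‖ ^ 2 := by
    have := (abs_le.1 (abs_real_inner_le_norm g e)).1
    nlinarith [sq_nonneg (‖g‖ - 10 * ‖e‖)]
  have hstep := h.mean_local_succ hk
  rw [← hz, ← hg, ← he, ← hw] at hstep
  have hηβ : η * β ≤ 1 / 10 := by linarith [h.step_β]
  have hηβ0 : 0 ≤ η * β := by positivity
  rw [hstep]
  constructor
  · refine (h.quadForm_sub_smul _ _).trans ?_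
    rw [← hg, hnorm, inner_add_right, inner_add_right, hgw, real_inner_self_eq_norm_sq]
    have h1 : η ^ 2 * β / 2 * ‖g + e‖ ^ 2 ≤ η * (1 / 10 * (‖g‖ ^ 2 + ‖e‖ ^ 2)) := by
      calc _ ≤ η ^ 2 * β / 2 * (2 * ‖g‖ ^ 2 + 2 * ‖e‖ ^ 2) := by gcongr
        _ = η * ((η * β) * (‖g‖ ^ 2 + ‖e‖ ^ 2)) := by ring
        _ ≤ _ := by gcongr
    have h2 : η ^ 2 * β / 2 * ‖w‖ ^ 2 ≤ η * (η * β * σ ^ 2 / N) / 2 := by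
      calc _ ≤ η ^ 2 * β / 2 * (σ ^ 2 / N) := by gcongr
        _ = _ := by ring
    have h3 := mul_le_mul_of_nonneg_left hinner hη.le
    linarith
  · have h1 : mean A (z - η • (g + e + w)) + b = g - η • mean A (g + e + w) := by
      rw [map_sub, map_smul, hg]; abel
    have h2 : ‖η • mean A (g + e + w)‖ ^ 2 ≤ (η * β) ^ 2 * (‖g + e‖ ^ 2 + ‖w‖ ^ 2) := by
      rw [← hnorm, ← mul_pow, norm_smul, Real.norm_of_nonneg hη.le, mul_assoc]
      gcongr
      exact h.norm_mean_apply_le _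
    have h3 : ‖g - η • mean A (g + e + w)‖ ^ 2
        ≤ 2 * ‖g‖ ^ 2 + 2 * ‖η • mean A (g + e + w)‖ ^ 2 := by
      have := pow_le_pow_left₀ (norm_nonneg _) (norm_sub_le g (η • mean A (g + e + w))) 2
      nlinarith [sq_nonneg (‖g‖ - ‖η • mean A (g + e + w)‖)]
    have h4 : (η * β) ^ 2 * ‖g + e‖ ^ 2 ≤ (1 / 10) ^ 2 * (2 * ‖g‖ ^ 2 + 2 * ‖e‖ ^ 2) := by
      gcongr
    have h5 : (η * β) ^ 2 * ‖w‖ ^ 2 ≤ 1 / 10 * (η * β * σ ^ 2 / N) := by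
      calc _ ≤ (η * β) ^ 2 * (σ ^ 2 / N) := by gcongr
        _ = (η * β) * (η * β * (σ ^ 2 / N)) := by ring
        _ ≤ 1 / 10 * (η * β * (σ ^ 2 / N)) := by gcongr
        _ = _ := by ring
    rw [h1]
    nlinarith [sq_nonneg ‖g‖, sq_nonneg ‖e‖]

lemma descent_from (h : IsRound A b x y ξ W K β δ σ η) {k : ℕ} (hk : k ≤ K) :
    quadForm (mean A) b (mean (fun i => y i K))
      ≤ quadForm (mean A) b (mean (fun i => y i k))
        - 17 / 20 * η * ∑ j ∈ Finset.Ico k K, ‖mean A (mean (fun i => y i j)) + b‖ ^ 2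
        + 1 / 20 * η * ∑ j ∈ Finset.range K, ‖mean A (mean (fun i => y i j)) + b‖ ^ 2
        + 2 * K * (η * (η * β * σ ^ 2 / N)) := by
  have hη := h.η_pos
  have hβ := h.β_pos
  have hN : (0 : ℝ) < N := by have := h.one_le; positivity
  set τ := η * β * σ ^ 2 / N with hτ
  have hτ0 : 0 ≤ τ := by positivity
  -- The errors are summed from step `0` although the descent starts at `k`, since the dissimilarity
  -- bound is for a full round.
  have key : ∀ m, k ≤ m → m ≤ K → quadForm (mean A) b (mean (fun i => y i m))
      ≤ quadForm (mean A) b (mean (fun i => y i k))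
        - 17 / 20 * η * ∑ j ∈ Finset.Ico k m, ‖mean A (mean (fun i => y i j)) + b‖ ^ 2
        + 51 / 10 * η * ∑ j ∈ Finset.range m, ‖dissimilarityError A x y j‖ ^ 2
        + m * (η * τ / 2) := by
    intro m hkm
    induction m, hkm using Nat.le_induction with
    | base =>
      intro _
      have : 0 ≤ ∑ j ∈ Finset.range k, ‖dissimilarityError A x y j‖ ^ 2 :=
        Finset.sum_nonneg fun _ _ => sq_nonneg _
      simp only [Finset.Ico_self, Finset.sum_empty]
      have h1 : 0 ≤ 51 / 10 * η * ∑ j ∈ Finset.range k, ‖dissimilarityError A x y j‖ ^ 2 := by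
        positivity
      have h2 : 0 ≤ k * (η * τ / 2) := by positivity
      linarith
    | succ m hkm ih =>
      intro hm
      have h1 := ih (by omega)
      have h2 := (h.step_descent (k := m) (by omega)).1
      rw [Finset.sum_Ico_succ_top hkm, Finset.sum_range_succ]
      push_cast
      linarith
  have h1 := key K hk le_rfl
  have h2 := mul_le_mul_of_nonneg_left h.sum_norm_dissimilarityError_sq_le
    (by positivity : 0 ≤ 51 / 10 * η)
  rw [← hτ] at h2
  have h3 : 0 ≤ ∑ k ∈ Finset.range K, ‖mean A (mean (fun i => y i k)) + b‖ ^ 2 :=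
    Finset.sum_nonneg fun _ _ => sq_nonneg _
  have h4 := mul_nonneg hη.le h3
  have h5 : 0 ≤ K * (η * τ) := by positivity
  -- The error constants fit because `51 / 10 / 150 ≤ 1 / 20` and `1 / 2 + 51 / 10 * 3 / 11 ≤ 2`.
  nlinarith

lemma quadForm_end_le (h : IsRound A b x y ξ W K β δ σ η) :
    quadForm (mean A) b (mean (fun i => y i K)) ≤ quadForm (mean A) b x
        - 4 / 5 * η * ∑ j ∈ Finset.range K, ‖mean A (mean (fun i => y i j)) + b‖ ^ 2
        + 2 * K * (η * (η * β * σ ^ 2 / N)) := by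
  have h1 := h.descent_from (Nat.zero_le K)
  simp only [h.init, mean_const h.one_le, Nat.Ico_zero_eq_range] at h1
  linarith

/-- The descent controls the gradients at steps `0, …, K - 1`, whereas the output is drawn from
steps `1, …, K`; this lemma bridges the shift. -/
lemma sum_norm_grad_succ_le (h : IsRound A b x y ξ W K β δ σ η) :
    ∑ j ∈ Finset.range K, ‖mean A (mean (fun i => y i (j + 1))) + b‖ ^ 2
      ≤ 3 * ∑ j ∈ Finset.range K, ‖mean A (mean (fun i => y i j)) + b‖ ^ 2
        + K * (η * β * σ ^ 2 / N) := by
  have hη := h.η_pos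
  have hβ := h.β_pos
  have hN : (0 : ℝ) < N := by have := h.one_le; positivity
  have h1 := Finset.sum_le_sum fun k (hk : k ∈ Finset.range K) =>
    (h.step_descent (Finset.mem_range.1 hk)).2
  rw [Finset.sum_add_distrib, Finset.sum_add_distrib, ← Finset.mul_sum, ← Finset.mul_sum,
    Finset.sum_const, Finset.card_range, nsmul_eq_mul] at h1
  have h2 := h.sum_norm_dissimilarityError_sq_le
  have h3 : 0 ≤ ∑ k ∈ Finset.range K, ‖mean A (mean (fun i => y i k)) + b‖ ^ 2 :=
    Finset.sum_nonneg fun _ _ => sq_nonneg _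
  have h5 : 0 ≤ K * (η * β * σ ^ 2 / N) := by positivity
  nlinarith

/-- Contraction of the optimality gap over a round under a Polyak–Łojasiewicz inequality. -/
lemma gap_contraction (h : IsRound A b x y ξ W K β δ σ η) {μ m : ℝ} (hμ : 0 < μ)
    (hstep : 10 * μ * K * η ≤ 1)
    (hPL : ∀ z, 2 * μ * (quadForm (mean A) b z - m) ≤ ‖mean A z + b‖ ^ 2)
    (hm : ∀ z, m ≤ quadForm (mean A) b z) :
    Real.exp (μ * η * K / 2) * (quadForm (mean A) b (mean (fun i => y i K)) - m)
        + 2 / 5 * η * ∑ j ∈ Finset.range K, ‖mean A (mean (fun i => y i j)) + b‖ ^ 2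
      ≤ quadForm (mean A) b x - m + 3 * K * (η * (η * β * σ ^ 2 / N)) := by
  have hη := h.η_pos
  have hβ := h.β_pos
  have hN : (0 : ℝ) < N := by have := h.one_le; positivity
  have key := gap_contraction_of_descent (K := K) hμ hη
    (by positivity : 0 ≤ η * β * σ ^ 2 / N) hstep
    (φ := fun k => quadForm (mean A) b (mean (fun i => y i k)))
    (g := fun k => ‖mean A (mean (fun i => y i k)) + b‖ ^ 2) (fun _ => sq_nonneg _)
    (fun k => hPL _) (hm _) (fun k hk => h.descent_from hk)
  simpa only [h.init, mean_const h.one_le] using key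

end IsRound

end Round

end

noncomputable section

/-! ### Quadratic objectives and the Polyak–Łojasiewicz inequality. -/

section Quadratic

variable {d : ℕ}

lemma gradient_quadratic {f : Vec d → ℝ} {A : Vec d →L[ℝ] Vec d} {b : Vec d} {c : ℝ}
    (hA : ∀ x y, inner ℝ (A x) y = inner ℝ x (A y))
    (hf : ∀ x, f x = (1 / 2) * inner ℝ x (A x) + inner ℝ b x + c) (x : Vec d) :
    ∇ f x = A x + b := by
  have hf' : f = fun x => (1 / 2) * inner ℝ x (A x) + inner ℝ b x + c := funext hf
  refine HasGradientAt.gradient ?_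
  rw [hasGradientAt_iff_hasFDerivAt, hf']
  have h1 : HasFDerivAt (fun x : Vec d => inner ℝ x (A x)) _ x :=
    (hasFDerivAt_id x).inner ℝ A.hasFDerivAt
  have h2 : HasFDerivAt (fun x : Vec d => inner ℝ b x) _ x :=
    (innerSL ℝ b).hasFDerivAt
  refine (((h1.const_mul (1 / 2)).add h2).add_const c).congr_fderiv ?_
  ext v
  simp [hA]
  rw [← hA, real_inner_comm]
  ring

lemma hess_quadratic {f : Vec d → ℝ} {A : Vec d →L[ℝ] Vec d} {b : Vec d} {c : ℝ}
    (hA : ∀ x y, inner ℝ (A x) y = inner ℝ x (A y))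
    (hf : ∀ x, f x = (1 / 2) * inner ℝ x (A x) + inner ℝ b x + c) (x : Vec d) :
    hess f x = A := by
  rw [hess, funext (gradient_quadratic hA hf)]
  exact (A.hasFDerivAt.add_const b).fderiv

variable {N : ℕ} {f : Fin N → Vec d → ℝ} {A : Fin N → Vec d →L[ℝ] Vec d} {b : Fin N → Vec d}
  {c : Fin N → ℝ}

lemma avgObjective_quadratic
    (hf : ∀ i x, f i x = (1 / 2) * inner ℝ x (A i x) + inner ℝ (b i) x + c i) (x : Vec d) :
    avgObjective f x = (1 / 2) * inner ℝ x (mean A x) + inner ℝ (mean b) x + mean c := by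
  rw [mean_apply, inner_mean, real_inner_comm, inner_mean]
  simp only [avgObjective, hf, mean, Finset.sum_add_distrib, ← Finset.mul_sum, smul_eq_mul]
  simp_rw [real_inner_comm x]
  ring

lemma norm_apply_le_of_isSmooth {f : Vec d → ℝ} {A : Vec d →L[ℝ] Vec d} {b : Vec d} {β : ℝ}
    (h : ∀ x, ∇ f x = A x + b) (hs : IsSmooth β f) (v : Vec d) : ‖A v‖ ≤ β * ‖v‖ := by
  simpa [h] using hs v 0

lemma le_inner_apply_of_isMuConvex {f : Vec d → ℝ} {A : Vec d →L[ℝ] Vec d} {b : Vec d} {c μ : ℝ}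
    (hA : ∀ x y, inner ℝ (A x) y = inner ℝ x (A y))
    (hf : ∀ x, f x = (1 / 2) * inner ℝ x (A x) + inner ℝ b x + c) (hs : IsMuConvex μ f)
    (v : Vec d) : μ * ‖v‖ ^ 2 ≤ inner ℝ v (A v) := by
  have := hs 0 v
  rw [gradient_quadratic hA hf, hf, hf] at this
  simp at this
  linarith

/-- The Polyak–Łojasiewicz inequality for strongly convex quadratics. -/
lemma two_mul_quadForm_sub_le {H : Type*} [NormedAddCommGroup H] [InnerProductSpace ℝ H]
    {A : H →L[ℝ] H} {b : H} {μ : ℝ} (hA : ∀ x y, inner ℝ (A x) y = inner ℝ x (A y)) (hμ : 0 < μ)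
    (hs : ∀ v, μ * ‖v‖ ^ 2 ≤ inner ℝ v (A v)) (z w : H) :
    2 * μ * (quadForm A b z - quadForm A b w) ≤ ‖A z + b‖ ^ 2 := by
  have h1 : quadForm A b w = quadForm A b z + inner ℝ (A z + b) (w - z)
      + 1 / 2 * inner ℝ (w - z) (A (w - z)) := by
    simp only [quadForm, map_sub, inner_sub_left, inner_sub_right, inner_add_left, ← hA z w]
    rw [real_inner_comm w (A z), real_inner_comm z (A z)]
    ring
  have h2 := hs (w - z)
  have h3 := (abs_le.1 (abs_real_inner_le_norm (A z + b) (w - z))).1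
  nlinarith [sq_nonneg (‖A z + b‖ - μ * ‖w - z‖)]

/-- The value `m` is the infimum, so no minimiser is needed: the inequality holds against every
competitor `w` and passes to the infimum. -/
lemma exists_quadForm_lower_bound {H : Type*} [NormedAddCommGroup H] [InnerProductSpace ℝ H]
    {A : H →L[ℝ] H} {b : H} {μ : ℝ} (hA : ∀ x y, inner ℝ (A x) y = inner ℝ x (A y)) (hμ : 0 < μ)
    (hs : ∀ v, μ * ‖v‖ ^ 2 ≤ inner ℝ v (A v)) :
    ∃ m, (∀ z, m ≤ quadForm A b z) ∧ (∀ z, 2 * μ * (quadForm A b z - m) ≤ ‖A z + b‖ ^ 2) ∧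
      ∀ l, (∀ z, l ≤ quadForm A b z) → l ≤ m := by
  have hPL := two_mul_quadForm_sub_le (b := b) hA hμ hs
  have key : ∀ z w, quadForm A b z - ‖A z + b‖ ^ 2 / (2 * μ) ≤ quadForm A b w := fun z w => by
    have := hPL z w
    have : quadForm A b z - quadForm A b w ≤ ‖A z + b‖ ^ 2 / (2 * μ) := by
      rw [le_div_iff₀ (by positivity)]; linarith
    linarith
  have hbdd : BddBelow (Set.range (quadForm A b)) :=
    ⟨_, by rintro _ ⟨w, rfl⟩; exact key 0 w⟩
  refine ⟨⨅ z, quadForm A b z, fun z => ciInf_le hbdd z, fun z => ?_, fun l hl => le_ciInf hl⟩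
  have h1 := le_ciInf (key z)
  have h2 : quadForm A b z - ⨅ z, quadForm A b z ≤ ‖A z + b‖ ^ 2 / (2 * μ) := by linarith
  rw [le_div_iff₀ (by positivity)] at h2
  linarith

end Quadratic

/-! ### Random vectors and pointwise operators in `L²`. -/

section Lift

variable {Ω : Type*} [MeasurableSpace Ω] {P : Measure Ω} {d : ℕ}

variable (P) in
open Classical in
/-- A square-integrable random vector as an element of `L²`; other functions are sent to `0`. -/
def toL2 (X : Ω → Vec d) : Lp (Vec d) 2 P :=
  if h : MemLp X 2 P then h.toLp X else 0

lemma coeFn_toL2 {X : Ω → Vec d} (h : MemLp X 2 P) : toL2 P X =ᵐ[P] X := by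
  rw [toL2, dif_pos h]
  exact h.coeFn_toLp

lemma toL2_congr {X : Ω → Vec d} (h : MemLp X 2 P) {v : Lp (Vec d) 2 P} (hv : v =ᵐ[P] X) :
    v = toL2 P X :=
  Lp.ext (hv.trans (coeFn_toL2 h).symm)

lemma inner_toL2 {X Y : Ω → Vec d} (hX : MemLp X 2 P) (hY : MemLp Y 2 P) :
    inner ℝ (toL2 P X) (toL2 P Y) = ∫ ω, inner ℝ (X ω) (Y ω) ∂P := by
  rw [L2.inner_def]
  refine integral_congr_ae ?_
  filter_upwards [coeFn_toL2 hX, coeFn_toL2 hY] with ω h1 h2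
  rw [h1, h2]

lemma norm_toL2_sq {X : Ω → Vec d} (hX : MemLp X 2 P) :
    ‖toL2 P X‖ ^ 2 = ∫ ω, ‖X ω‖ ^ 2 ∂P := by
  rw [← real_inner_self_eq_norm_sq, inner_toL2 hX hX]
  simp_rw [real_inner_self_eq_norm_sq]

variable (P) in
/-- The pointwise action of an operator on square-integrable random vectors. -/
abbrev liftL2 (L : Vec d →L[ℝ] Vec d) : Lp (Vec d) 2 P →L[ℝ] Lp (Vec d) 2 P :=
  L.compLpL 2 P

lemma coeFn_liftL2 (L : Vec d →L[ℝ] Vec d) (v : Lp (Vec d) 2 P) :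
    liftL2 P L v =ᵐ[P] fun ω => L (v ω) :=
  L.coeFn_compLpL v

lemma liftL2_toL2 (L : Vec d →L[ℝ] Vec d) {X : Ω → Vec d} (hX : MemLp X 2 P) :
    liftL2 P L (toL2 P X) = toL2 P (fun ω => L (X ω)) := by
  refine toL2_congr (L.comp_memLp' hX) ?_
  filter_upwards [coeFn_liftL2 L (toL2 P X), coeFn_toL2 hX] with ω h1 h2
  rw [h1, h2]
  rfl

lemma inner_liftL2 {L : Vec d →L[ℝ] Vec d} (hL : ∀ x y, inner ℝ (L x) y = inner ℝ x (L y))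
    (v w : Lp (Vec d) 2 P) : inner ℝ (liftL2 P L v) w = inner ℝ v (liftL2 P L w) := by
  rw [L2.inner_def, L2.inner_def]
  refine integral_congr_ae ?_
  filter_upwards [coeFn_liftL2 L v, coeFn_liftL2 L w] with ω h1 h2
  rw [h1, h2, hL]

lemma norm_liftL2_le {L : Vec d →L[ℝ] Vec d} {c : ℝ} (hL : ∀ v, ‖L v‖ ≤ c * ‖v‖)
    (v : Lp (Vec d) 2 P) : ‖liftL2 P L v‖ ≤ c * ‖v‖ := by
  refine Lp.norm_le_mul_norm_of_ae_le_mul ?_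
  filter_upwards [coeFn_liftL2 L v] with ω h1
  rw [h1]
  exact hL _

lemma le_inner_liftL2 {L : Vec d →L[ℝ] Vec d} {c : ℝ} (hL : ∀ v, c * ‖v‖ ^ 2 ≤ inner ℝ v (L v))
    (v : Lp (Vec d) 2 P) : c * ‖v‖ ^ 2 ≤ inner ℝ v (liftL2 P L v) := by
  rw [← real_inner_self_eq_norm_sq, L2.inner_def, L2.inner_def, ← integral_const_mul]
  refine integral_mono_ae ((L2.integrable_inner v v).const_mul c) (L2.integrable_inner v _) ?_
  filter_upwards [coeFn_liftL2 L v] with ω h1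
  rw [h1, real_inner_self_eq_norm_sq]
  exact hL _

lemma mean_liftL2 {N : ℕ} (A : Fin N → Vec d →L[ℝ] Vec d) :
    mean (fun i => liftL2 P (A i)) = liftL2 P (mean A) := by
  have h1 : ∀ s : Finset (Fin N), ∑ i ∈ s, liftL2 P (A i) = liftL2 P (∑ i ∈ s, A i) := by
    intro s
    induction s using Finset.induction_on with
    | empty =>
      ext1 v
      refine (Lp.ext ?_ : (0 : Lp (Vec d) 2 P) = _)
      filter_upwards [coeFn_liftL2 (P := P) (0 : Vec d →L[ℝ] Vec d) v,
        Lp.coeFn_zero (Vec d) 2 P] with ω h1 h2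
      simpa using h2.trans h1.symm
    | insert a s ha ih =>
      rw [Finset.sum_insert ha, Finset.sum_insert ha, ih]
      exact (ContinuousLinearMap.add_compLpL _ _).symm
  rw [mean, h1, mean]
  exact (ContinuousLinearMap.smul_compLpL _ _).symm

end Lift

end

noncomputable section

section L2

variable {Ω : Type*} [MeasurableSpace Ω] {P : Measure Ω} {d : ℕ}

lemma toL2_add {X Y : Ω → Vec d} (hX : MemLp X 2 P) (hY : MemLp Y 2 P) :
    toL2 P (fun ω => X ω + Y ω) = toL2 P X + toL2 P Y := by
  refine (toL2_congr (hX.add hY) ?_).symm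
  filter_upwards [Lp.coeFn_add (toL2 P X) (toL2 P Y), coeFn_toL2 hX, coeFn_toL2 hY] with ω h1 h2 h3
  rw [h1, Pi.add_apply, h2, h3, Pi.add_apply]

lemma toL2_sub {X Y : Ω → Vec d} (hX : MemLp X 2 P) (hY : MemLp Y 2 P) :
    toL2 P (fun ω => X ω - Y ω) = toL2 P X - toL2 P Y := by
  refine (toL2_congr (hX.sub hY) ?_).symm
  filter_upwards [Lp.coeFn_sub (toL2 P X) (toL2 P Y), coeFn_toL2 hX, coeFn_toL2 hY] with ω h1 h2 h3
  rw [h1, Pi.sub_apply, h2, h3, Pi.sub_apply]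

lemma toL2_smul (c : ℝ) {X : Ω → Vec d} (hX : MemLp X 2 P) :
    toL2 P (fun ω => c • X ω) = c • toL2 P X := by
  refine (toL2_congr (hX.const_smul c) ?_).symm
  filter_upwards [Lp.coeFn_smul c (toL2 P X), coeFn_toL2 hX] with ω h1 h2
  rw [h1, Pi.smul_apply, h2, Pi.smul_apply]

lemma memLp_mean {N : ℕ} {X : Fin N → Ω → Vec d} (hX : ∀ i, MemLp (X i) 2 P) :
    MemLp (fun ω => mean (fun i => X i ω)) 2 P :=
  (memLp_finsetSum Finset.univ fun i _ => hX i).const_smul (1 / (N : ℝ))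

lemma measurable_mean {N : ℕ} {X : Fin N → Ω → Vec d} (hX : ∀ i, Measurable (X i)) :
    Measurable (fun ω => mean (fun i => X i ω)) :=
  (Finset.measurable_sum _ fun i _ => hX i).fun_const_smul (1 / (N : ℝ))

lemma toL2_mean {N : ℕ} {X : Fin N → Ω → Vec d} (hX : ∀ i, MemLp (X i) 2 P) :
    toL2 P (fun ω => mean (fun i => X i ω)) = mean (fun i => toL2 P (X i)) := by
  have h1 : ∀ s : Finset (Fin N),
      toL2 P (fun ω => ∑ i ∈ s, X i ω) = ∑ i ∈ s, toL2 P (X i) := by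
    intro s
    induction s using Finset.induction_on with
    | empty =>
      simp only [Finset.sum_empty]
      exact (toL2_congr (MemLp.zero' (p := 2)) (Lp.coeFn_zero (Vec d) 2 P)).symm
    | insert a s ha ih =>
      simp_rw [Finset.sum_insert ha]
      rw [toL2_add (hX a) (memLp_finsetSum s fun i _ => hX i), ih]
  rw [mean, ← h1, ← toL2_smul _ (memLp_finsetSum _ fun i _ => hX i)]
  rfl

lemma integrable_inner_of_memLp {X Y : Ω → Vec d} (hX : MemLp X 2 P) (hY : MemLp Y 2 P) :
    Integrable (fun ω => inner ℝ (X ω) (Y ω)) P := by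
  refine (L2.integrable_inner (𝕜 := ℝ) (toL2 P X) (toL2 P Y)).congr ?_
  filter_upwards [coeFn_toL2 hX, coeFn_toL2 hY] with ω h1 h2
  rw [h1, h2]

end L2

/-! ### Fresh samples as orthogonality in `L²`. -/

section LpMeas

variable {Ω : Type*} {m mΩ : MeasurableSpace Ω} {P : Measure Ω} {d : ℕ}

lemma toL2_mem_lpMeas {X : Ω → Vec d}
    (hX : MemLp X 2 P) (hm : Measurable[m] X) : toL2 P X ∈ lpMeas (Vec d) ℝ m 2 P := by
  rw [mem_lpMeas_iff_aestronglyMeasurable]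
  exact ⟨X, hm.stronglyMeasurable, coeFn_toL2 hX⟩

lemma liftL2_mem_lpMeas (L : Vec d →L[ℝ] Vec d)
    {v : Lp (Vec d) 2 P} (hv : v ∈ lpMeas (Vec d) ℝ m 2 P) :
    liftL2 P L v ∈ lpMeas (Vec d) ℝ m 2 P := by
  rw [mem_lpMeas_iff_aestronglyMeasurable] at hv ⊢
  obtain ⟨X, hX, hvX⟩ := hv
  refine ⟨fun ω => L (X ω), L.continuous.comp_stronglyMeasurable hX, ?_⟩
  filter_upwards [coeFn_liftL2 L v, hvX] with ω h1 h2
  rw [h1, h2]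

end LpMeas

section Sampling

variable {Ω Z : Type*} {m mΩ : MeasurableSpace Ω} {P : Measure Ω} [MeasurableSpace Z]
  {ζ : Ω → Z} {d : ℕ} {h : Vec d → Z → Vec d} {Y : Ω → Vec d} {D : Measure Z}

lemma indepFun_of_measurable {β : Type*} [MeasurableSpace β] {X : Ω → β}
    (hX : Measurable[m] X) (hind : Indep m (MeasurableSpace.comap ζ inferInstance) P) :
    IndepFun X ζ P := by
  rw [IndepFun_iff_Indep]
  exact indep_of_indep_of_le_left hind hX.comap_le

/-- Second moment of `h (Y, ζ)` for a sample `ζ` that is independent of `Y`. -/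
lemma memLp_sample [IsProbabilityMeasure P] (hm : m ≤ mΩ) (hζ : Measurable ζ)
    (hind : Indep m (MeasurableSpace.comap ζ inferInstance) P) (hD : P.map ζ = D)
    (hh : Measurable (Function.uncurry h)) (hY : Measurable[m] Y) {s : ℝ} (hs : 0 ≤ s)
    (hsq : ∀ y, Integrable (fun z => ‖h y z‖ ^ 2) D) (hle : ∀ y, ∫ z, ‖h y z‖ ^ 2 ∂D ≤ s) :
    MemLp (fun ω => h (Y ω) (ζ ω)) 2 P ∧ ∫ ω, ‖h (Y ω) (ζ ω)‖ ^ 2 ∂P ≤ s := by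
  have hYm : Measurable Y := hY.mono hm le_rfl
  have hmeas : Measurable (fun ω => h (Y ω) (ζ ω)) := hh.comp (hYm.prodMk hζ)
  have hlaw := (indepFun_of_measurable hY hind).map_prod_eq_prod_map_map hYm.aemeasurable
    hζ.aemeasurable
  have : IsProbabilityMeasure D := hD ▸ Measure.isProbabilityMeasure_map hζ.aemeasurable
  have : IsProbabilityMeasure (P.map Y) := Measure.isProbabilityMeasure_map hYm.aemeasurable
  have hF : Measurable (fun q : Vec d × Z => ENNReal.ofReal (‖Function.uncurry h q‖ ^ 2)) :=
    (hh.norm.pow_const 2).ennreal_ofReal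
  have hlin : ∫⁻ ω, ENNReal.ofReal (‖h (Y ω) (ζ ω)‖ ^ 2) ∂P ≤ ENNReal.ofReal s := by
    have h1 : ∫⁻ ω, ENNReal.ofReal (‖h (Y ω) (ζ ω)‖ ^ 2) ∂P
        = ∫⁻ q, ENNReal.ofReal (‖Function.uncurry h q‖ ^ 2) ∂(P.map fun ω => (Y ω, ζ ω)) :=
      (lintegral_map hF (hYm.prodMk hζ)).symm
    rw [h1, hlaw, hD, lintegral_prod _ hF.aemeasurable]
    calc _ ≤ ∫⁻ _y, ENNReal.ofReal s ∂(P.map Y) := by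
          refine lintegral_mono fun y => ?_
          simp only [Function.uncurry]
          rw [← ofReal_integral_eq_lintegral_ofReal (hsq y)
            (Filter.Eventually.of_forall fun _ => sq_nonneg _)]
          exact ENNReal.ofReal_le_ofReal (hle y)
      _ = _ := by simp
  have hint : Integrable (fun ω => ‖h (Y ω) (ζ ω)‖ ^ 2) P := by
    refine (lintegral_ofReal_ne_top_iff_integrable (hmeas.norm.pow_const 2).aestronglyMeasurable
      (Filter.Eventually.of_forall fun _ => sq_nonneg _)).1 ?_
    exact (hlin.trans_lt ENNReal.ofReal_lt_top).ne
  refine ⟨(memLp_two_iff_integrable_sq_norm hmeas.aestronglyMeasurable).2 hint, ?_⟩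
  rw [integral_eq_lintegral_of_nonneg_ae (Filter.Eventually.of_forall fun _ => sq_nonneg _)
    (hmeas.norm.pow_const 2).aestronglyMeasurable]
  exact ENNReal.toReal_le_of_le_ofReal hs hlin

/-- A centred function of a fresh sample is orthogonal to everything the sample is independent
of. -/
lemma inner_toL2_sample_eq_zero [IsProbabilityMeasure P] (hm : m ≤ mΩ) (hζ : Measurable ζ)
    (hind : Indep m (MeasurableSpace.comap ζ inferInstance) P) (hD : P.map ζ = D)
    (hh : Measurable (Function.uncurry h)) (hY : Measurable[m] Y)
    (hint : ∀ y, Integrable (h y) D) (hzero : ∀ y, ∫ z, h y z ∂D = 0)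
    (hL2 : MemLp (fun ω => h (Y ω) (ζ ω)) 2 P) {v : Lp (Vec d) 2 P}
    (hv : v ∈ lpMeas (Vec d) ℝ m 2 P) : inner ℝ v (toL2 P fun ω => h (Y ω) (ζ ω)) = 0 := by
  rw [mem_lpMeas_iff_aestronglyMeasurable] at hv
  obtain ⟨X, hX, hvX⟩ := hv
  have hXm : Measurable[m] X := hX.measurable
  have hX2 : MemLp X 2 P := (memLp_congr_ae hvX).1 (Lp.memLp v)
  -- The pair is treated jointly, so that the law of `((X, Y), ζ)` is a product and Fubini
  -- integrates over `ζ` with `X` and `Y` fixed.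
  have hXY : Measurable[m] (fun ω => (X ω, Y ω)) := hXm.prodMk hY
  have hXYm : Measurable (fun ω => (X ω, Y ω)) := hXY.mono hm le_rfl
  have hlaw := (indepFun_of_measurable hXY hind).map_prod_eq_prod_map_map hXYm.aemeasurable
    hζ.aemeasurable
  have : IsProbabilityMeasure D := hD ▸ Measure.isProbabilityMeasure_map hζ.aemeasurable
  have : IsProbabilityMeasure (P.map fun ω => (X ω, Y ω)) :=
    Measure.isProbabilityMeasure_map hXYm.aemeasurable
  have hF : Measurable (fun q : (Vec d × Vec d) × Z => inner ℝ q.1.1 (h q.1.2 q.2)) :=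
    (measurable_fst.fst).inner (hh.comp (measurable_fst.snd.prodMk measurable_snd))
  rw [toL2_congr hX2 hvX, inner_toL2 hX2 hL2]
  have hmap : ∫ ω, inner ℝ (X ω) (h (Y ω) (ζ ω)) ∂P
      = ∫ q, inner ℝ q.1.1 (h q.1.2 q.2) ∂(P.map fun ω => ((X ω, Y ω), ζ ω)) :=
    (integral_map (hXYm.prodMk hζ).aemeasurable hF.aestronglyMeasurable).symm
  have hI : Integrable (fun q : (Vec d × Vec d) × Z => inner ℝ q.1.1 (h q.1.2 q.2))
      (P.map fun ω => ((X ω, Y ω), ζ ω)) := by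
    rw [integrable_map_measure hF.aestronglyMeasurable (hXYm.prodMk hζ).aemeasurable]
    exact integrable_inner_of_memLp hX2 hL2
  rw [hmap]
  rw [hlaw, hD] at hI ⊢
  rw [integral_prod _ hI]
  refine integral_eq_zero_of_ae (Filter.Eventually.of_forall fun q => ?_)
  simp only [Pi.zero_apply]
  rw [integral_inner (hint q.2), hzero, inner_zero_right]

end Sampling

/-! ### Measurability of the iterates. -/

section Models

variable {Ω Z : Type*} [MeasurableSpace Ω] [MeasurableSpace Z] {N d : ℕ}
  {f : Fin N → Vec d → ℝ} {g : Fin N → Vec d → Z → Vec d}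

lemma measurable_localModel (hg : ∀ i, Measurable (Function.uncurry (g i)))
    (hf : ∀ i, Measurable (∇ (f i))) (η : ℝ) {X : Ω → Vec d} (hX : Measurable X) (i : Fin N)
    {z : ℕ → Ω → Z} {k : ℕ} (hz : ∀ l < k, Measurable (z l)) :
    Measurable (fun ω => localModel f g η (X ω) i (fun l => z l ω) k) := by
  induction k with
  | zero => exact hX
  | succ k ih =>
    have h1 := ih fun l hl => hz l (by omega)
    have h2 : Measurable (fun ω => g i (localModel f g η (X ω) i (fun l => z l ω) k) (z k ω)) :=
      (hg i).comp (h1.prodMk (hz k (by omega)))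
    have h3 : Measurable (fun ω => (1 / (N : ℝ)) • ∑ j, ∇ (f j) (X ω)) :=
      (Finset.measurable_sum _ fun j _ => (hf j).comp hX).fun_const_smul _
    exact h1.sub (((h2.sub ((hf i).comp hX)).add h3).const_smul η)

lemma measurable_serverModel (hg : ∀ i, Measurable (Function.uncurry (g i)))
    (hf : ∀ i, Measurable (∇ (f i))) (η ηg : ℝ) (K : ℕ) (x₀ : Vec d)
    {z : ℕ → Fin N → ℕ → Ω → Z} {r : ℕ}
    (hz : ∀ s < r, ∀ i, ∀ k < K, Measurable (z s i k)) :
    Measurable (fun ω => serverModel f g η ηg K x₀ (fun r i k => z r i k ω) r) := by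
  induction r with
  | zero => exact measurable_const
  | succ r ih =>
    have h1 := ih fun s hs => hz s (by omega)
    have h2 : Measurable (fun ω => (1 / (N : ℝ)) • ∑ i,
        (localModel f g η (serverModel f g η ηg K x₀ (fun r i k => z r i k ω) r) i
          (fun k => z r i k ω) K - serverModel f g η ηg K x₀ (fun r i k => z r i k ω) r)) :=
      (Finset.measurable_sum _ fun i _ =>
        (measurable_localModel hg hf η h1 i fun l hl => hz r (by omega) i l hl).sub h1).fun_const_smul _
    exact h1.add (h2.const_smul ηg)

end Models

end

noncomputable section

/-! ### A SCAFFOLD round as an instance of the Hilbert space model. -/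

namespace ScaffoldRun

variable {N K R d : ℕ} {β δ σ η : ℝ} {p : PMF (Fin R × Fin K)}
  (S : ScaffoldRun N K R d β δ σ η 1 p)

/-- The σ-algebra generated by the samples with index in `Q`. -/
@[reducible]
def sampleAlgebra (Q : Set (Fin R × Fin N × Fin K)) : MeasurableSpace S.Ω :=
  ⨆ t ∈ Q, MeasurableSpace.comap (S.ζ t.1 t.2.1 t.2.2) inferInstance

/-- The server model after `r` rounds. -/
def server (r : ℕ) (ω : S.Ω) : Vec d :=
  serverModel S.f S.g η 1 K S.x₀ (fun r i k => S.ζ r i k ω) r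

/-- The local models of round `r + 1`. -/
def loc (r : ℕ) (i : Fin N) (k : ℕ) (ω : S.Ω) : Vec d :=
  localModel S.f S.g η (S.server r ω) i (fun k => S.ζ r i k ω) k

/-- The averaged local models of round `r + 1`. -/
def avg (r k : ℕ) (ω : S.Ω) : Vec d := mean (fun i => S.loc r i k ω)

/-- The gradient noise in the local steps of round `r + 1`. -/
def noise (r : ℕ) (i : Fin N) (k : ℕ) (ω : S.Ω) : Vec d :=
  S.g i (S.loc r i k ω) (S.ζ r i k ω) - ∇ (S.f i) (S.loc r i k ω)

lemma sampleAlgebra_le (Q : Set (Fin R × Fin N × Fin K)) :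
    S.sampleAlgebra Q ≤ S.measurableSpaceΩ :=
  iSup₂_le fun t _ => (S.measurable_ζ t.1 t.2.1 t.2.2).comap_le

lemma measurable_sample {Q : Set (Fin R × Fin N × Fin K)} {r k : ℕ} {i : Fin N} (hr : r < R)
    (hk : k < K) (h : (⟨r, hr⟩, i, ⟨k, hk⟩) ∈ Q) : Measurable[S.sampleAlgebra Q] (S.ζ r i k) := by
  rw [measurable_iff_comap_le]
  exact le_iSup₂_of_le (f := fun (t : Fin R × Fin N × Fin K) (_ : t ∈ Q) =>
    MeasurableSpace.comap (S.ζ t.1 t.2.1 t.2.2) inferInstance) _ h le_rfl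

lemma indep_sampleAlgebra {r k : ℕ} {i : Fin N} (hr : r < R) (hk : k < K) :
    Indep (S.sampleAlgebra {(⟨r, hr⟩, i, ⟨k, hk⟩)}ᶜ)
      (MeasurableSpace.comap (S.ζ r i k) inferInstance) S.P := by
  have h := indep_iSup_of_disjoint
    (m := fun t : Fin R × Fin N × Fin K =>
      MeasurableSpace.comap (S.ζ t.1 t.2.1 t.2.2) inferInstance)
    (fun t => (S.measurable_ζ t.1 t.2.1 t.2.2).comap_le) S.indep_ζ.iIndep
    (S := {((⟨r, hr⟩, i, ⟨k, hk⟩) : Fin R × Fin N × Fin K)}ᶜ)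
    (T := {((⟨r, hr⟩, i, ⟨k, hk⟩) : Fin R × Fin N × Fin K)}) disjoint_compl_left
  rw [iSup_singleton] at h
  exact h

lemma measurable_gradient (i : Fin N) : Measurable (∇ (S.f i)) := by
  obtain ⟨A, b, c, hA, hf⟩ := S.quadratic i
  rw [funext (gradient_quadratic hA hf)]
  exact (A.continuous.add continuous_const).measurable

lemma measurable_server {Q : Set (Fin R × Fin N × Fin K)} {r : ℕ} (hr : r ≤ R)
    (hQ : ∀ t : Fin R × Fin N × Fin K, t.1.val < r → t ∈ Q) :
    Measurable[S.sampleAlgebra Q] (S.server r) :=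
  -- The general lemma is applied with the σ-algebra of the samples in `Q` in place of the ambient
  -- one, which records on which samples the model depends.
  @measurable_serverModel _ _ (S.sampleAlgebra Q) _ _ _ _ _
    (fun i => (S.stochasticGradient i).measurable) S.measurable_gradient η 1 K S.x₀ S.ζ r
    fun _ hs _ _ hk => S.measurable_sample (by omega) hk (hQ _ hs)

lemma measurable_loc {Q : Set (Fin R × Fin N × Fin K)} {r k : ℕ} {i : Fin N} (hr : r < R)
    (hk : k ≤ K) (hQ : ∀ t : Fin R × Fin N × Fin K, t.1.val < r → t ∈ Q)
    (hQ' : ∀ t : Fin R × Fin N × Fin K, t.1.val = r → t.2.1 = i → t.2.2.val < k → t ∈ Q) :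
    Measurable[S.sampleAlgebra Q] (S.loc r i k) :=
  @measurable_localModel _ _ (S.sampleAlgebra Q) _ _ _ _ _
    (fun i => (S.stochasticGradient i).measurable) S.measurable_gradient η _
    (S.measurable_server hr.le hQ) i (S.ζ r i) k
    fun l hl => S.measurable_sample hr (by omega) (hQ' _ rfl rfl hl)

lemma measurable_noise {Q : Set (Fin R × Fin N × Fin K)} {r k : ℕ} {i : Fin N} (hr : r < R)
    (hk : k < K) (hQ : ∀ t : Fin R × Fin N × Fin K, t.1.val < r → t ∈ Q)
    (hQ' : ∀ t : Fin R × Fin N × Fin K, t.1.val = r → t.2.1 = i → t.2.2.val ≤ k → t ∈ Q) :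
    Measurable[S.sampleAlgebra Q] (S.noise r i k) := by
  have h1 := S.measurable_loc (i := i) hr hk.le hQ fun t h1 h2 h3 => hQ' t h1 h2 h3.le
  have h2 := S.measurable_sample (Q := Q) (i := i) hr hk (hQ' _ rfl rfl le_rfl)
  exact ((S.stochasticGradient i).measurable.comp (h1.prodMk h2)).sub
    ((S.measurable_gradient i).comp h1)

lemma measurable_centred (i : Fin N) :
    Measurable (Function.uncurry fun x z => S.g i x z - ∇ (S.f i) x) :=
  (S.stochasticGradient i).measurable.sub ((S.measurable_gradient i).comp measurable_fst)

lemma measurable_loc_compl {r k : ℕ} (i : Fin N) (hr : r < R) (hk : k < K) :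
    Measurable[S.sampleAlgebra {(⟨r, hr⟩, i, ⟨k, hk⟩)}ᶜ] (S.loc r i k) := by
  refine S.measurable_loc hr hk.le (fun t ht h => ?_) (fun t _ _ ht h => ?_)
  · rw [Set.mem_singleton_iff.1 h] at ht
    exact lt_irrefl _ ht
  · rw [Set.mem_singleton_iff.1 h] at ht
    exact lt_irrefl _ ht

lemma memLp_noise {r k : ℕ} (i : Fin N) (hr : r < R) (hk : k < K) :
    MemLp (S.noise r i k) 2 S.P ∧ ∫ ω, ‖S.noise r i k ω‖ ^ 2 ∂S.P ≤ σ ^ 2 :=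
  memLp_sample (S.sampleAlgebra_le _) (S.measurable_ζ r i k) (S.indep_sampleAlgebra hr hk)
    (S.law_ζ r hr i k hk) (S.measurable_centred i) (S.measurable_loc_compl i hr hk) (sq_nonneg σ)
    (S.stochasticGradient i).integrable_sq (S.stochasticGradient i).variance_le

lemma inner_noise_eq_zero {r k : ℕ} (i : Fin N) (hr : r < R) (hk : k < K) {v : Lp (Vec d) 2 S.P}
    (hv : v ∈ lpMeas (Vec d) ℝ (S.sampleAlgebra {(⟨r, hr⟩, i, ⟨k, hk⟩)}ᶜ) 2 S.P) :
    inner ℝ v (toL2 S.P (S.noise r i k)) = 0 := by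
  have hD := S.law_ζ r hr i k hk
  have : IsProbabilityMeasure (S.D i) :=
    hD ▸ Measure.isProbabilityMeasure_map (S.measurable_ζ r i k).aemeasurable
  refine inner_toL2_sample_eq_zero (h := fun x z => S.g i x z - ∇ (S.f i) x)
    (S.sampleAlgebra_le _) (S.measurable_ζ r i k)
    (S.indep_sampleAlgebra hr hk) hD (S.measurable_centred i) (S.measurable_loc_compl i hr hk)
    (fun y => ((S.stochasticGradient i).integrable y).sub (integrable_const _)) (fun y => ?_)
    (S.memLp_noise i hr hk).1 hv
  rw [integral_sub ((S.stochasticGradient i).integrable y) (integrable_const _),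
    (S.stochasticGradient i).unbiased]
  simp

lemma loc_zero (r : ℕ) (i : Fin N) : S.loc r i 0 = S.server r := rfl

lemma server_succ (hN : 1 ≤ N) (r : ℕ) : S.server (r + 1) = S.avg r K := by
  funext ω
  have h : S.server (r + 1) ω
      = S.server r ω + (1 : ℝ) • mean (fun i => S.loc r i K ω - S.server r ω) := rfl
  rw [h, mean_sub, mean_const hN, one_smul, avg]
  abel

section Linear

variable {A : Fin N → Vec d →L[ℝ] Vec d} {b : Fin N → Vec d}

lemma loc_succ (hgrad : ∀ i x, ∇ (S.f i) x = A i x + b i) (r : ℕ) (i : Fin N) (k : ℕ) (ω : S.Ω) :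
    S.loc r i (k + 1) ω = S.loc r i k ω - η • (A i (S.loc r i k ω - S.server r ω)
      + (mean A (S.server r ω) + mean b) + S.noise r i k ω) := by
  have h : S.loc r i (k + 1) ω = S.loc r i k ω - η • (S.g i (S.loc r i k ω) (S.ζ r i k ω)
      - ∇ (S.f i) (S.server r ω) + mean (fun j => ∇ (S.f j) (S.server r ω))) := rfl
  rw [h, noise]
  simp only [hgrad]
  rw [mean_add, ← mean_apply, map_sub]
  congr 2
  have : mean b = mean (fun i => b i) := rfl
  rw [this]
  abel

/-- The variance bound is uniform in the point of evaluation, so the noise is square-integrable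
whatever the local model is; the induction is therefore not circular. -/
lemma memLp_loc_of_server (hgrad : ∀ i x, ∇ (S.f i) x = A i x + b i) {r : ℕ} (hr : r < R)
    (hs : MemLp (S.server r) 2 S.P) (i : Fin N) {k : ℕ} (hk : k ≤ K) :
    MemLp (S.loc r i k) 2 S.P := by
  induction k with
  | zero => exact hs
  | succ k ih =>
    have h1 := ih (by omega)
    rw [funext (S.loc_succ hgrad r i k)]
    exact h1.sub (((((A i).comp_memLp' (h1.sub hs)).add
      (((mean A).comp_memLp' hs).add (memLp_const _))).add
      (S.memLp_noise i hr (by omega)).1).const_smul η)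

lemma memLp_server (hN : 1 ≤ N) (hgrad : ∀ i x, ∇ (S.f i) x = A i x + b i) {r : ℕ}
    (hr : r ≤ R) : MemLp (S.server r) 2 S.P := by
  induction r with
  | zero => exact memLp_const S.x₀
  | succ r ih =>
    rw [S.server_succ hN]
    exact memLp_mean fun i => S.memLp_loc_of_server hgrad (by omega) (ih (by omega)) i le_rfl

lemma memLp_loc (hN : 1 ≤ N) (hgrad : ∀ i x, ∇ (S.f i) x = A i x + b i) {r : ℕ} (hr : r < R)
    (i : Fin N) {k : ℕ} (hk : k ≤ K) : MemLp (S.loc r i k) 2 S.P :=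
  S.memLp_loc_of_server hgrad hr (S.memLp_server hN hgrad hr.le) i hk

lemma memLp_avg (hN : 1 ≤ N) (hgrad : ∀ i x, ∇ (S.f i) x = A i x + b i) {r : ℕ} (hr : r < R)
    {k : ℕ} (hk : k ≤ K) : MemLp (S.avg r k) 2 S.P :=
  memLp_mean fun i => S.memLp_loc hN hgrad hr i hk

/-- The square-integrable random vectors that do not use the sample with index `(r, i, k)`. -/
def withoutSample (r : ℕ) (i : Fin N) (k : ℕ) : Submodule ℝ (Lp (Vec d) 2 S.P) :=
  lpMeas (Vec d) ℝ
    (S.sampleAlgebra {t | ¬ (t.1.val = r ∧ t.2.1 = i ∧ t.2.2.val = k)}) 2 S.P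

lemma isRound (hN : 1 ≤ N) (hη : 0 < η) (hδ : 0 ≤ δ) (hβ : 0 < β) (hβη : 10 * β * η ≤ 1)
    (hδη : 22 * δ * K * η ≤ 1) (hgrad : ∀ i x, ∇ (S.f i) x = A i x + b i)
    (hA : ∀ i x y, inner ℝ (A i x) y = inner ℝ x (A i y))
    (hdis : ∀ i v, ‖A i v - mean A v‖ ≤ δ * ‖v‖)
    (hlow : ∀ v, -δ * ‖v‖ ^ 2 ≤ inner ℝ v (mean A v)) {r : ℕ} (hr : r < R) :
    IsRound (fun i => liftL2 S.P (A i)) (toL2 S.P fun _ => mean b) (toL2 S.P (S.server r))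
      (fun i k => toL2 S.P (S.loc r i k)) (fun i k => toL2 S.P (S.noise r i k))
      (S.withoutSample r) K β δ σ η where
  one_le := hN
  η_pos := hη
  δ_nonneg := hδ
  β_pos := hβ
  step_β := hβη
  step_δ := hδη
  symm i v w := inner_liftL2 (hA i) v w
  norm_le i v := norm_liftL2_le (norm_apply_le_of_isSmooth (hgrad i) (S.smooth i)) v
  dissim i v := by
    rw [mean_liftL2]
    refine Lp.norm_le_mul_norm_of_ae_le_mul ?_
    filter_upwards [coeFn_liftL2 (A i) v, coeFn_liftL2 (mean A) v,
      Lp.coeFn_sub (liftL2 S.P (A i) v) (liftL2 S.P (mean A) v)] with ω h1 h2 h3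
    rw [h3, Pi.sub_apply, h1, h2]
    exact hdis i _
  lower v := by
    rw [mean_liftL2]
    exact le_inner_liftL2 hlow v
  init i := rfl
  step i k hk := by
    have hs := S.memLp_server hN hgrad hr.le
    have hl := S.memLp_loc hN hgrad hr i hk.le
    have hn := (S.memLp_noise i hr hk).1
    have hc : MemLp (fun _ : S.Ω => mean b) 2 S.P := memLp_const _
    have h1 : MemLp (fun ω => A i (S.loc r i k ω - S.server r ω)) 2 S.P :=
      (A i).comp_memLp' (hl.sub hs)
    have h2 : MemLp (fun ω => mean A (S.server r ω)) 2 S.P := (mean A).comp_memLp' hs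
    have h3 : MemLp (fun ω => mean A (S.server r ω) + mean b) 2 S.P := h2.add hc
    have h4 : MemLp (fun ω => A i (S.loc r i k ω - S.server r ω)
        + (mean A (S.server r ω) + mean b)) 2 S.P := h1.add h3
    have h5 : MemLp (fun ω => A i (S.loc r i k ω - S.server r ω)
        + (mean A (S.server r ω) + mean b) + S.noise r i k ω) 2 S.P := h4.add hn
    have h6 : MemLp (fun ω => η • (A i (S.loc r i k ω - S.server r ω)
        + (mean A (S.server r ω) + mean b) + S.noise r i k ω)) 2 S.P := h5.const_smul η
    have h7 : MemLp (fun ω => S.loc r i k ω - S.server r ω) 2 S.P := hl.sub hs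
    have h8 : toL2 S.P (S.loc r i (k + 1)) = toL2 S.P (fun ω => S.loc r i k ω
      - η • (A i (S.loc r i k ω - S.server r ω)
        + (mean A (S.server r ω) + mean b) + S.noise r i k ω)) :=
      congrArg (toL2 S.P) (funext (S.loc_succ hgrad r i k))
    rw [h8, toL2_sub hl h6, toL2_smul _ h5, toL2_add h4 hn, toL2_add h1 h3, toL2_add h2 hc,
      ← liftL2_toL2 (mean A) hs, ← liftL2_toL2 (A i) h7, mean_liftL2, toL2_sub hl hs]
  apply_mem i k j v hv := liftL2_mem_lpMeas (A j) hv
  init_mem i k hk := toL2_mem_lpMeas (S.memLp_server hN hgrad hr.le)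
    (S.measurable_server hr.le fun t ht h => by omega)
  const_mem i k hk := toL2_mem_lpMeas (memLp_const _) measurable_const
  noise_mem i k hk j l hl h := toL2_mem_lpMeas (S.memLp_noise j hr hl).1
    (S.measurable_noise hr hl (fun t ht h => by omega) (fun t h1 h2 h3 h4 => by
      rcases h with h | h
      · exact h (h2.symm.trans h4.2.1)
      · omega))
  orth i k hk v hv := by
    refine S.inner_noise_eq_zero i hr hk ?_
    -- The subspaces `withoutSample` are indexed by natural numbers so as to exist for all indices;
    -- within range they omit exactly one sample.
    have : ({(⟨r, hr⟩, i, ⟨k, hk⟩)} : Set (Fin R × Fin N × Fin K))ᶜ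
        = {t | ¬ (t.1.val = r ∧ t.2.1 = i ∧ t.2.2.val = k)} := by
      ext ⟨t1, t2, t3⟩
      simp [Fin.ext_iff]
    rw [this]
    exact hv
  noise_le i k hk := by
    rw [norm_toL2_sq (S.memLp_noise i hr hk).1]
    exact (S.memLp_noise i hr hk).2

end Linear

end ScaffoldRun

end

noncomputable section

/-! ### Expected objective values and gradients. -/

namespace ScaffoldRun

variable {N K R d : ℕ} {β δ σ η : ℝ} {p : PMF (Fin R × Fin K)}
  (S : ScaffoldRun N K R d β δ σ η 1 p)

/-- The expected objective value at the server model after `r` rounds. -/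
def expObj (r : ℕ) : ℝ := ∫ ω, S.obj (S.server r ω) ∂S.P

/-- The expected squared gradient norm at the averaged local models. -/
def expSqGrad (r k : ℕ) : ℝ := ∫ ω, ‖∇ S.obj (S.avg r k ω)‖ ^ 2 ∂S.P

section Linear

variable {S} {A : Fin N → Vec d →L[ℝ] Vec d} {b : Fin N → Vec d} {c : Fin N → ℝ}

lemma obj_eq (hf : ∀ i x, S.f i x = (1 / 2) * inner ℝ x (A i x) + inner ℝ (b i) x + c i)
    (x : Vec d) : S.obj x = (1 / 2) * inner ℝ x (mean A x) + inner ℝ (mean b) x + mean c :=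
  avgObjective_quadratic hf x

lemma gradient_obj (hA : ∀ i x y, inner ℝ (A i x) y = inner ℝ x (A i y))
    (hf : ∀ i x, S.f i x = (1 / 2) * inner ℝ x (A i x) + inner ℝ (b i) x + c i) (x : Vec d) :
    ∇ S.obj x = mean A x + mean b :=
  gradient_quadratic (mean_symm_of_symm hA) (obj_eq hf) x

lemma integrable_obj
    (hf : ∀ i x, S.f i x = (1 / 2) * inner ℝ x (A i x) + inner ℝ (b i) x + c i)
    {X : S.Ω → Vec d} (hX : MemLp X 2 S.P) : Integrable (fun ω => S.obj (X ω)) S.P := by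
  simp_rw [obj_eq hf]
  exact (((integrable_inner_of_memLp hX ((mean A).comp_memLp' hX)).const_mul (1 / 2)).add
    (integrable_inner_of_memLp (memLp_const (mean b)) hX)).add (integrable_const _)

lemma integral_obj
    (hf : ∀ i x, S.f i x = (1 / 2) * inner ℝ x (A i x) + inner ℝ (b i) x + c i)
    {X : S.Ω → Vec d} (hX : MemLp X 2 S.P) :
    ∫ ω, S.obj (X ω) ∂S.P = quadForm (mean fun i => liftL2 S.P (A i)) (toL2 S.P fun _ => mean b)
      (toL2 S.P X) + mean c := by
  have h1 : MemLp (fun ω => mean A (X ω)) 2 S.P := (mean A).comp_memLp' hX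
  have h2 : MemLp (fun _ : S.Ω => mean b) 2 S.P := memLp_const _
  have h3 := integrable_inner_of_memLp hX h1
  have h4 := integrable_inner_of_memLp h2 hX
  rw [mean_liftL2, quadForm, liftL2_toL2 _ hX, inner_toL2 hX h1, inner_toL2 h2 hX]
  simp_rw [obj_eq hf]
  have h5 : Integrable (fun ω => 1 / 2 * inner ℝ (X ω) (mean A (X ω)) + inner ℝ (mean b) (X ω))
    S.P := (h3.const_mul _).add h4
  rw [integral_add h5 (integrable_const _),
    integral_add (h3.const_mul _) h4, integral_const_mul]
  simp

lemma toL2_gradient (hA : ∀ i x y, inner ℝ (A i x) y = inner ℝ x (A i y))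
    (hf : ∀ i x, S.f i x = (1 / 2) * inner ℝ x (A i x) + inner ℝ (b i) x + c i)
    {X : S.Ω → Vec d} (hX : MemLp X 2 S.P) :
    MemLp (fun ω => ∇ S.obj (X ω)) 2 S.P ∧
      ∫ ω, ‖∇ S.obj (X ω)‖ ^ 2 ∂S.P = ‖mean (fun i => liftL2 S.P (A i)) (toL2 S.P X)
        + toL2 S.P fun _ => mean b‖ ^ 2 := by
  have h1 : MemLp (fun ω => mean A (X ω)) 2 S.P := (mean A).comp_memLp' hX
  have h2 : MemLp (fun _ : S.Ω => mean b) 2 S.P := memLp_const _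
  have h3 : MemLp (fun ω => mean A (X ω) + mean b) 2 S.P := h1.add h2
  simp_rw [gradient_obj hA hf]
  refine ⟨h3, ?_⟩
  rw [mean_liftL2, liftL2_toL2 _ hX, ← toL2_add h1 h2, norm_toL2_sq h3]

lemma gradient_eq (hA : ∀ i x y, inner ℝ (A i x) y = inner ℝ x (A i y))
    (hf : ∀ i x, S.f i x = (1 / 2) * inner ℝ x (A i x) + inner ℝ (b i) x + c i) (i : Fin N)
    (x : Vec d) : ∇ (S.f i) x = A i x + b i :=
  gradient_quadratic (hA i) (hf i) x

lemma norm_sub_mean_le (hA : ∀ i x y, inner ℝ (A i x) y = inner ℝ x (A i y))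
    (hf : ∀ i x, S.f i x = (1 / 2) * inner ℝ x (A i x) + inner ℝ (b i) x + c i) (i : Fin N)
    (v : Vec d) : ‖A i v - mean A v‖ ≤ δ * ‖v‖ := by
  have h := S.dissimilarity i 0
  rw [hess_quadratic (hA i) (hf i),
    hess_quadratic (mean_symm_of_symm hA) (avgObjective_quadratic hf)] at h
  exact (A i - mean A).le_of_opNorm_le h v

lemma isRound_of_isWeaklyConvex (hN : 1 ≤ N) (hη : 0 < η) (hδ : 0 ≤ δ) (hβ : 0 < β)
    (hβη : 10 * β * η ≤ 1) (hδη : 22 * δ * K * η ≤ 1)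
    (hA : ∀ i x y, inner ℝ (A i x) y = inner ℝ x (A i y))
    (hf : ∀ i x, S.f i x = (1 / 2) * inner ℝ x (A i x) + inner ℝ (b i) x + c i)
    (hw : IsWeaklyConvex δ S.obj) {r : ℕ} (hr : r < R) :
    IsRound (fun i => liftL2 S.P (A i)) (toL2 S.P fun _ => mean b) (toL2 S.P (S.server r))
      (fun i k => toL2 S.P (S.loc r i k)) (fun i k => toL2 S.P (S.noise r i k))
      (S.withoutSample r) K β δ σ η := by
  refine S.isRound hN hη hδ hβ hβη hδη (gradient_eq hA hf) hA (norm_sub_mean_le hA hf) ?_ hr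
  intro v
  have := hw 0 v
  rwa [hess_quadratic (mean_symm_of_symm hA) (obj_eq hf)] at this

lemma toL2_avg (hN : 1 ≤ N) (hgrad : ∀ i x, ∇ (S.f i) x = A i x + b i) {r k : ℕ} (hr : r < R)
    (hk : k ≤ K) : toL2 S.P (S.avg r k) = mean (fun i => toL2 S.P (S.loc r i k)) :=
  toL2_mean fun i => S.memLp_loc hN hgrad hr i hk

lemma expObj_eq (hN : 1 ≤ N)
    (hA : ∀ i x y, inner ℝ (A i x) y = inner ℝ x (A i y))
    (hf : ∀ i x, S.f i x = (1 / 2) * inner ℝ x (A i x) + inner ℝ (b i) x + c i) {r : ℕ}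
    (hr : r ≤ R) : S.expObj r = quadForm (mean fun i => liftL2 S.P (A i))
      (toL2 S.P fun _ => mean b) (toL2 S.P (S.server r)) + mean c :=
  integral_obj hf (S.memLp_server hN (gradient_eq hA hf) hr)

lemma expSqGrad_eq (hN : 1 ≤ N)
    (hA : ∀ i x y, inner ℝ (A i x) y = inner ℝ x (A i y))
    (hf : ∀ i x, S.f i x = (1 / 2) * inner ℝ x (A i x) + inner ℝ (b i) x + c i) {r k : ℕ}
    (hr : r < R) (hk : k ≤ K) : S.expSqGrad r k = ‖mean (fun i => liftL2 S.P (A i))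
      (mean fun i => toL2 S.P (S.loc r i k)) + toL2 S.P fun _ => mean b‖ ^ 2 := by
  rw [expSqGrad, (toL2_gradient hA hf (S.memLp_avg hN (gradient_eq hA hf) hr hk)).2,
    toL2_avg hN (gradient_eq hA hf) hr hk]

lemma toL2_server_succ (hN : 1 ≤ N) (hgrad : ∀ i x, ∇ (S.f i) x = A i x + b i) {r : ℕ}
    (hr : r < R) : toL2 S.P (S.server (r + 1)) = mean (fun i => toL2 S.P (S.loc r i K)) := by
  rw [S.server_succ hN, toL2_avg hN hgrad hr le_rfl]

end Linear

lemma exists_linear : ∃ (A : Fin N → Vec d →L[ℝ] Vec d) (b : Fin N → Vec d) (c : Fin N → ℝ),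
    (∀ i x y, inner ℝ (A i x) y = inner ℝ x (A i y)) ∧
    ∀ i x, S.f i x = (1 / 2) * inner ℝ x (A i x) + inner ℝ (b i) x + c i := by
  choose A b c hA hf using S.quadratic
  exact ⟨A, b, c, hA, hf⟩

/-- Expected descent of the objective over a round. -/
lemma expObj_succ_le (hN : 1 ≤ N) (hη : 0 < η) (hδ : 0 ≤ δ) (hβ : 0 < β)
    (hβη : 10 * β * η ≤ 1) (hδη : 22 * δ * K * η ≤ 1) (hw : IsWeaklyConvex δ S.obj) {r : ℕ}
    (hr : r < R) :
    S.expObj (r + 1) ≤ S.expObj r - 4 / 5 * η * ∑ k ∈ Finset.range K, S.expSqGrad r k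
      + 2 * K * (η * (η * β * σ ^ 2 / N)) := by
  obtain ⟨A, b, c, hA, hf⟩ := S.exists_linear
  have h := (isRound_of_isWeaklyConvex hN hη hδ hβ hβη hδη hA hf hw hr).quadForm_end_le
  rw [expObj_eq hN hA hf hr, expObj_eq hN hA hf hr.le,
    toL2_server_succ hN (gradient_eq hA hf) hr, Finset.sum_congr rfl fun k hk =>
      expSqGrad_eq hN hA hf hr (Finset.mem_range.1 hk).le]
  linarith

lemma sum_expSqGrad_succ_le (hN : 1 ≤ N) (hη : 0 < η) (hδ : 0 ≤ δ) (hβ : 0 < β)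
    (hβη : 10 * β * η ≤ 1) (hδη : 22 * δ * K * η ≤ 1) (hw : IsWeaklyConvex δ S.obj) {r : ℕ}
    (hr : r < R) :
    ∑ k ∈ Finset.range K, S.expSqGrad r (k + 1)
      ≤ 3 * ∑ k ∈ Finset.range K, S.expSqGrad r k + K * (η * β * σ ^ 2 / N) := by
  obtain ⟨A, b, c, hA, hf⟩ := S.exists_linear
  have h := (isRound_of_isWeaklyConvex hN hη hδ hβ hβη hδη hA hf hw hr).sum_norm_grad_succ_le
  rw [Finset.sum_congr rfl fun k hk => expSqGrad_eq hN hA hf hr (Finset.mem_range.1 hk).le,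
    Finset.sum_congr rfl fun k hk =>
      expSqGrad_eq hN hA hf hr (Nat.succ_le_of_lt (Finset.mem_range.1 hk))]
  exact h

lemma le_inner_mean_apply {A : Fin N → Vec d →L[ℝ] Vec d} (hN : 1 ≤ N) {μ : ℝ}
    (h : ∀ i v, μ * ‖v‖ ^ 2 ≤ inner ℝ v (A i v)) (v : Vec d) :
    μ * ‖v‖ ^ 2 ≤ inner ℝ v (mean A v) := by
  rw [mean_apply, inner_mean]
  calc μ * ‖v‖ ^ 2 = mean (fun _ : Fin N => μ * ‖v‖ ^ 2) := (mean_const hN _).symm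
    _ ≤ _ := mean_le_mean fun i => h i v

lemma isWeaklyConvex_of_isMuConvex (hN : 1 ≤ N) (hδ : 0 ≤ δ) {μ : ℝ} (hμ : 0 < μ)
    (hs : ∀ i, IsMuConvex μ (S.f i)) : IsWeaklyConvex δ S.obj := by
  obtain ⟨A, b, c, hA, hf⟩ := S.exists_linear
  intro x v
  rw [hess_quadratic (mean_symm_of_symm hA) (obj_eq hf)]
  have h1 := le_inner_mean_apply hN
    (fun i v => le_inner_apply_of_isMuConvex (hA i) (hf i) (hs i) v) v
  have h2 : 0 ≤ δ * ‖v‖ ^ 2 := by positivity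
  have h3 : 0 ≤ μ * ‖v‖ ^ 2 := by positivity
  linarith

/-- Contraction of the expected optimality gap over a round for strongly convex clients. -/
lemma exists_expObj_gap_contraction (hN : 1 ≤ N) (hη : 0 < η) (hδ : 0 ≤ δ) (hβ : 0 < β)
    (hβη : 10 * β * η ≤ 1) (hδη : 22 * δ * K * η ≤ 1) {μ : ℝ} (hμ : 0 < μ)
    (hμη : 10 * μ * K * η ≤ 1) (hs : ∀ i, IsMuConvex μ (S.f i)) {fstar : ℝ}
    (hstar : ∀ x, fstar ≤ S.obj x) :
    ∃ m, fstar ≤ m ∧ (∀ r ≤ R, m ≤ S.expObj r) ∧ ∀ r < R,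
      Real.exp (μ * η * K / 2) * (S.expObj (r + 1) - m)
        + 2 / 5 * η * ∑ k ∈ Finset.range K, S.expSqGrad r k
      ≤ S.expObj r - m + 3 * K * (η * (η * β * σ ^ 2 / N)) := by
  obtain ⟨A, b, c, hA, hf⟩ := S.exists_linear
  have hw := S.isWeaklyConvex_of_isMuConvex hN hδ hμ hs
  have hlift : ∀ v w, inner ℝ (mean (fun i => liftL2 S.P (A i)) v) w
      = inner ℝ v (mean (fun i => liftL2 S.P (A i)) w) :=
    mean_symm_of_symm fun i v w => inner_liftL2 (hA i) v w
  have hlow : ∀ v, μ * ‖v‖ ^ 2 ≤ inner ℝ v (mean (fun i => liftL2 S.P (A i)) v) := by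
    rw [mean_liftL2]
    exact le_inner_liftL2 (le_inner_mean_apply hN
      fun i v => le_inner_apply_of_isMuConvex (hA i) (hf i) (hs i) v)
  -- The infimum is over all square-integrable random vectors, so the bounds hold directly for
  -- expectations. It dominates `fstar` because the objective does so pointwise.
  obtain ⟨m, hm, hPL, hmax⟩ :=
    exists_quadForm_lower_bound (b := toL2 S.P fun _ => mean b) hlift hμ hlow
  refine ⟨m + mean c, ?_, fun r hr => ?_, fun r hr => ?_⟩
  · rw [← sub_le_iff_le_add]
    refine hmax _ fun z => ?_
    have hz : MemLp z 2 S.P := Lp.memLp z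
    have h1 := integral_obj hf hz
    rw [← toL2_congr hz (Filter.EventuallyEq.refl _ _)] at h1
    have h2 : ∫ _ω, fstar ∂S.P ≤ ∫ ω, S.obj (z ω) ∂S.P :=
      integral_mono (integrable_const _) (integrable_obj hf hz) fun ω => hstar _
    rw [h1] at h2
    simp only [integral_const, probReal_univ, smul_eq_mul, one_mul] at h2
    linarith
  · rw [expObj_eq hN hA hf hr]
    linarith [hm (toL2 S.P (S.server r))]
  · have h := (isRound_of_isWeaklyConvex hN hη hδ hβ hβη hδη hA hf hw hr).gap_contraction hμ hμη
      hPL hm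
    rw [expObj_eq hN hA hf hr, expObj_eq hN hA hf hr.le,
      toL2_server_succ hN (gradient_eq hA hf) hr, Finset.sum_congr rfl fun k hk =>
        expSqGrad_eq hN hA hf hr (Finset.mem_range.1 hk).le]
    convert h using 2 <;> ring

lemma le_expObj_final (hN : 1 ≤ N) {fstar : ℝ}
    (hstar : ∀ᵐ ω ∂S.P, fstar ≤ S.obj (S.finalModel ω)) : fstar ≤ S.expObj R := by
  obtain ⟨A, b, c, hA, hf⟩ := S.exists_linear
  have h2 : ∫ _ω, fstar ∂S.P ≤ ∫ ω, S.obj (S.finalModel ω) ∂S.P :=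
    integral_mono_ae (integrable_const _)
      (integrable_obj hf (S.memLp_server hN (gradient_eq hA hf) le_rfl)) hstar
  simp only [integral_const, probReal_univ, smul_eq_mul, one_mul] at h2
  exact h2

lemma expObj_zero : S.expObj 0 = S.obj S.x₀ := by
  have : S.expObj 0 = ∫ _ω, S.obj S.x₀ ∂S.P := rfl
  simp [this]

lemma sampleAlgebra_le_comap (Q : Set (Fin R × Fin N × Fin K)) :
    S.sampleAlgebra Q ≤ MeasurableSpace.comap
      (fun ω (t : Fin R × Fin N × Fin K) => S.ζ t.1 t.2.1 t.2.2 ω) inferInstance := by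
  refine iSup₂_le fun t _ => ?_
  have h := measurable_pi_apply (X := fun _ : Fin R × Fin N × Fin K => S.Z) t
  exact (h.comp (comap_measurable
    (fun ω (t : Fin R × Fin N × Fin K) => S.ζ t.1 t.2.1 t.2.2 ω))).comap_le

/-- The expected squared gradient norm at the output is the average over the random index. -/
lemma integral_sqGrad (hN : 1 ≤ N) : Integrable S.sqGrad S.P ∧
    ∫ ω, S.sqGrad ω ∂S.P
      = ∑ j : Fin R × Fin K, (p j).toReal * S.expSqGrad j.1 (j.2 + 1) := by
  obtain ⟨A, b, c, hA, hf⟩ := S.exists_linear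
  set φ : Fin R × Fin K → S.Ω → ℝ := fun j ω => ‖∇ S.obj (S.avg j.1 (j.2 + 1) ω)‖ ^ 2 with hφ
  -- Indicators of the output index turn the random choice into a finite sum of products of
  -- independent factors.
  set u : Fin R × Fin K → S.Ω → ℝ := fun j ω => if S.J ω = j then 1 else 0 with hu
  have hsq : ∀ ω, S.sqGrad ω = ∑ j, u j ω * φ j ω := by
    intro ω
    simp only [hu, ite_mul, one_mul, zero_mul, Finset.sum_ite_eq, Finset.mem_univ, if_true]
    rfl
  have hgm : Measurable (∇ S.obj) := by
    rw [funext (gradient_obj hA hf)]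
    exact ((mean A).continuous.add continuous_const).measurable
  have hφm : ∀ j, Measurable[S.sampleAlgebra Set.univ] (φ j) := by
    intro j
    have h1 : Measurable[S.sampleAlgebra Set.univ] (S.avg j.1 (j.2 + 1)) :=
      @measurable_mean _ (S.sampleAlgebra Set.univ) _ _ _ fun i =>
        S.measurable_loc j.1.2 j.2.2 (fun _ _ => Set.mem_univ _) (fun _ _ _ _ => Set.mem_univ _)
    exact (hgm.norm.pow_const 2).comp h1
  have hφi : ∀ j, Integrable (φ j) S.P := fun j =>
    (toL2_gradient hA hf (S.memLp_avg hN (gradient_eq hA hf) j.1.2 j.2.2)).1.integrable_norm_pow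
      (by norm_num)
  have hum : ∀ j, Measurable (fun x : Fin R × Fin K => if x = j then (1 : ℝ) else 0) := fun j =>
    measurable_of_finite _
  have hind : ∀ j, IndepFun (u j) (φ j) S.P := by
    intro j
    have h := S.indep_J
    rw [IndepFun_iff_Indep] at h ⊢
    refine indep_of_indep_of_le_left (indep_of_indep_of_le_right h
      ((hφm j).comap_le.trans (S.sampleAlgebra_le_comap _))) ?_
    exact ((hum j).comp (comap_measurable S.J)).comap_le
  have hui : ∀ j, ∫ ω, u j ω ∂S.P = (p j).toReal := by
    intro j
    have h1 : u j = (S.J ⁻¹' {j}).indicator 1 := by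
      funext ω
      by_cases h : S.J ω = j <;> simp [hu, h, Set.indicator]
    rw [h1, integral_indicator_one (S.measurable_J (measurableSet_singleton j)), Measure.real,
      S.law_J]
  have hprod : ∀ j, Integrable (fun ω => u j ω * φ j ω) S.P := fun j =>
    (hφi j).bdd_mul (c := 1) ((hum j).comp S.measurable_J).aestronglyMeasurable
      (Filter.Eventually.of_forall fun ω => by simp only [hu]; split_ifs <;> simp)
  rw [funext hsq]
  refine ⟨integrable_finsetSum _ fun j _ => hprod j, ?_⟩
  rw [integral_finsetSum _ fun j _ => hprod j]
  refine Finset.sum_congr rfl fun j _ => ?_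
  have h1 := (hind j).integral_mul_eq_mul_integral
    ((hum j).comp S.measurable_J).aestronglyMeasurable (hφi j).aestronglyMeasurable
  rw [hui] at h1
  exact h1

end ScaffoldRun

end

/-! ### Output distribution and convergence for a given step size. -/

noncomputable section

/-- Output probabilities that are geometric in the round and uniform within a round. -/
lemma exists_geometric_pmf {R K : ℕ} (hR : 1 ≤ R) (hK : 1 ≤ K) {q : ℝ} (hq : 0 < q) :
    ∃ p : PMF (Fin R × Fin K), ∀ j,
      (p j).toReal = q ^ (j.1 : ℕ) / (K * ∑ s ∈ Finset.range R, q ^ s) := by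
  have hQ : 0 < ∑ s ∈ Finset.range R, q ^ s :=
    Finset.sum_pos (fun _ _ => by positivity) ⟨0, Finset.mem_range.2 hR⟩
  have hK' : (0 : ℝ) < K := by positivity
  have h1 : ∑ j : Fin R × Fin K, q ^ (j.1 : ℕ) / (K * ∑ s ∈ Finset.range R, q ^ s) = 1 := by
    rw [← Finset.sum_div, Fintype.sum_prod_type]
    simp only [Finset.sum_const, Finset.card_univ, Fintype.card_fin, nsmul_eq_mul]
    rw [← Finset.mul_sum, Fin.sum_univ_eq_sum_range (fun r => q ^ r), div_self (by positivity)]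
  refine ⟨PMF.ofFintype (fun j => ENNReal.ofReal
    (q ^ (j.1 : ℕ) / (K * ∑ s ∈ Finset.range R, q ^ s))) ?_, fun j => ?_⟩
  · rw [← ENNReal.ofReal_sum_of_nonneg fun _ _ => by positivity, h1, ENNReal.ofReal_one]
  · rw [PMF.ofFintype_apply, ENNReal.toReal_ofReal (by positivity)]

namespace ScaffoldRun

variable {N K R d : ℕ} {β δ σ η : ℝ} {p : PMF (Fin R × Fin K)}
  (S : ScaffoldRun N K R d β δ σ η 1 p)

lemma integral_sqGrad_geometric (hN : 1 ≤ N) {q : ℝ}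
    (hp : ∀ j, (p j).toReal = q ^ (j.1 : ℕ) / (K * ∑ s ∈ Finset.range R, q ^ s)) :
    ∫ ω, S.sqGrad ω ∂S.P = (∑ r ∈ Finset.range R, q ^ r *
      ∑ k ∈ Finset.range K, S.expSqGrad r (k + 1)) / (K * ∑ s ∈ Finset.range R, q ^ s) := by
  rw [(S.integral_sqGrad hN).2, Fintype.sum_prod_type,
    ← Fin.sum_univ_eq_sum_range (fun r => q ^ r * ∑ k ∈ Finset.range K, S.expSqGrad r (k + 1)),
    Finset.sum_div]
  refine Finset.sum_congr rfl fun r _ => ?_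
  rw [← Fin.sum_univ_eq_sum_range (fun k => S.expSqGrad r (k + 1)), Finset.mul_sum,
    Finset.sum_div]
  refine Finset.sum_congr rfl fun k _ => ?_
  rw [hp]
  ring

/-- Convergence for weakly convex objectives with a uniformly random output. -/
lemma integral_sqGrad_le_of_isWeaklyConvex (hN : 1 ≤ N) (hK : 1 ≤ K) (hR : 1 ≤ R)
    (hη : 0 < η) (hδ : 0 ≤ δ) (hβ : 0 < β)
    (hβη : 10 * β * η ≤ 1) (hδη : 22 * δ * K * η ≤ 1)
    (hp : ∀ j, (p j).toReal = 1 ^ (j.1 : ℕ) / (K * ∑ s ∈ Finset.range R, 1 ^ s))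
    (hw : IsWeaklyConvex δ S.obj) {fstar F : ℝ} (hFn : 0 ≤ F)
    (hstar : ∀ᵐ ω ∂S.P, fstar ≤ S.obj (S.finalModel ω)) (hF : S.obj S.x₀ - fstar ≤ F) :
    ∫ ω, S.sqGrad ω ∂S.P ≤ 4 * F / (η * R * K) + 9 * (η * β * σ ^ 2 / N) := by
  have hN' : (0 : ℝ) < N := by positivity
  have hK' : (0 : ℝ) < K := by positivity
  have hR' : (0 : ℝ) < R := by positivity
  rw [S.integral_sqGrad_geometric hN hp]
  simp only [one_pow, one_mul, Finset.sum_const, Finset.card_range, nsmul_eq_mul, mul_one]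
  have hfin := S.le_expObj_final hN hstar
  rw [← S.expObj_zero] at hF
  set τ := η * β * σ ^ 2 / N with hτ
  have hτ0 : 0 ≤ τ := by positivity
  have h1 := Finset.sum_le_sum fun r (hr : r ∈ Finset.range R) =>
    S.expObj_succ_le hN hη hδ hβ hβη hδη hw (Finset.mem_range.1 hr)
  have h2 := Finset.sum_le_sum fun r (hr : r ∈ Finset.range R) =>
    S.sum_expSqGrad_succ_le hN hη hδ hβ hβη hδη hw (Finset.mem_range.1 hr)
  simp only [Finset.sum_add_distrib, Finset.sum_sub_distrib, ← Finset.mul_sum, Finset.sum_const,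
    Finset.card_range, nsmul_eq_mul, ← hτ] at h1 h2
  have h3 := Finset.sum_range_sub S.expObj R
  rw [Finset.sum_sub_distrib] at h3
  generalize ∑ r ∈ Finset.range R, ∑ k ∈ Finset.range K, S.expSqGrad r k = G at *
  generalize ∑ r ∈ Finset.range R, ∑ k ∈ Finset.range K, S.expSqGrad r (k + 1) = G' at *
  -- Only the final value needs the lower bound `fstar`, since the descent telescopes over the
  -- rounds.
  have h4 : 4 / 5 * η * G ≤ F + R * (2 * K * (η * τ)) := by linarith
  have h5 : η * G' ≤ 15 / 4 * F + 17 / 2 * (R * K * (η * τ)) := by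
    have := mul_le_mul_of_nonneg_left h2 hη.le
    linarith
  have hF0 : 0 ≤ η * (R * K * τ) := by positivity
  rw [div_le_iff₀ (by positivity)]
  have h6 : (4 * F / (η * R * K) + 9 * τ) * (K * R) = (4 * F + 9 * (R * K * (η * τ))) / η := by
    field_simp
  rw [h6, le_div_iff₀ hη]
  linarith

/-- Convergence for strongly convex clients with a geometrically distributed output round. -/
lemma integral_sqGrad_le_of_isMuConvex (hN : 1 ≤ N) (hK : 1 ≤ K) (hR : 1 ≤ R)
    (hη : 0 < η) (hδ : 0 ≤ δ) (hβ : 0 < β)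
    (hβη : 10 * β * η ≤ 1) (hδη : 22 * δ * K * η ≤ 1) {μ : ℝ} (hμ : 0 < μ)
    (hμη : 10 * μ * K * η ≤ 1) (hlong : 1 ≤ μ * η * K * R)
    (hp : ∀ j, (p j).toReal = Real.exp (μ * η * K / 2) ^ (j.1 : ℕ)
      / (K * ∑ s ∈ Finset.range R, Real.exp (μ * η * K / 2) ^ s))
    (hs : ∀ i, IsMuConvex μ (S.f i)) {fstar F : ℝ} (hstar : ∀ x, fstar ≤ S.obj x)
    (hF : S.obj S.x₀ - fstar ≤ F) :
    ∫ ω, S.sqGrad ω ∂S.P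
      ≤ 14 * (μ * F * Real.exp (-(μ * η * K * R / 2))) + 24 * (η * β * σ ^ 2 / N) := by
  have hN' : (0 : ℝ) < N := by positivity
  have hK' : (0 : ℝ) < K := by positivity
  have hR' : (0 : ℝ) < R := by positivity
  have hF0 : 0 ≤ F := by linarith [hstar S.x₀]
  rw [S.integral_sqGrad_geometric hN hp]
  obtain ⟨m, hm1, hm2, hm3⟩ := S.exists_expObj_gap_contraction hN hη hδ hβ hβη hδη hμ hμη hs hstar
  have hw := S.isWeaklyConvex_of_isMuConvex hN hδ hμ hs
  rw [← S.expObj_zero] at hF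
  set τ := η * β * σ ^ 2 / N with hτ
  have hτ0 : 0 ≤ τ := by positivity
  set q := Real.exp (μ * η * K / 2) with hq
  have hq0 : 0 < q := Real.exp_pos _
  set Q := ∑ s ∈ Finset.range R, q ^ s with hQ
  have hQ0 : 0 < Q := Finset.sum_pos (fun _ _ => by positivity) ⟨0, Finset.mem_range.2 hR⟩
  have hQgeom : Q * (q - 1) = q ^ R - 1 := geom_sum_mul q R
  have hq1 : q - 1 ≤ 3 / 5 * (μ * η * K) := by
    linarith [exp_le_one_add (x := μ * η * K) (by positivity) (by linarith)]
  have hqR : q ^ R = Real.exp (μ * η * K * R / 2) := by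
    rw [hq, ← Real.exp_nat_mul]; congr 1; ring
  -- The exponent is at least `1 / 2` by `hlong`. Hence `q ^ R - 1 ≥ q ^ R / 3`, which bounds the
  -- geometric sum `Q` from below.
  have hqR1 : 3 / 2 ≤ q ^ R := by
    rw [hqR]; linarith [Real.add_one_le_exp (μ * η * K * R / 2)]
  have hQlow : q ^ R / 3 ≤ Q * (3 / 5 * (μ * η * K)) := by
    have := mul_le_mul_of_nonneg_left hq1 hQ0.le
    linarith
  -- The weight `q ^ n` matches the contraction factor of a round, so the weighted gaps telescope.
  have h1 : ∀ n ≤ R, q ^ n * (S.expObj n - m)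
      + 2 / 5 * η * ∑ r ∈ Finset.range n, q ^ r * ∑ k ∈ Finset.range K, S.expSqGrad r k
      ≤ S.expObj 0 - m + 3 * K * (η * τ) * ∑ r ∈ Finset.range n, q ^ r := by
    intro n hn
    induction n with
    | zero => simp
    | succ n ih =>
      have h2 := mul_le_mul_of_nonneg_left (hm3 n (by omega)) (by positivity : 0 ≤ q ^ n)
      have h3 := ih (by omega)
      rw [Finset.sum_range_succ, Finset.sum_range_succ, pow_succ]
      linarith
  have h2 := h1 R le_rfl
  have h3 : 0 ≤ q ^ R * (S.expObj R - m) :=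
    mul_nonneg (by positivity) (by linarith [hm2 R le_rfl])
  have h4 := Finset.sum_le_sum fun r (hr : r ∈ Finset.range R) =>
    mul_le_mul_of_nonneg_left
      (S.sum_expSqGrad_succ_le hN hη hδ hβ hβη hδη hw (Finset.mem_range.1 hr))
      (by positivity : 0 ≤ q ^ r)
  simp only [mul_add, Finset.sum_add_distrib, ← Finset.sum_mul, mul_left_comm _ (3 : ℝ),
    ← Finset.mul_sum, ← hτ, ← hQ] at h4
  rw [← hQ] at h2
  generalize ∑ r ∈ Finset.range R, q ^ r * ∑ k ∈ Finset.range K, S.expSqGrad r k = G at *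
  generalize ∑ r ∈ Finset.range R, q ^ r * ∑ k ∈ Finset.range K, S.expSqGrad r (k + 1) = G' at *
  have h5 : η * G' ≤ 15 / 2 * F + 24 * (K * (η * τ) * Q) := by
    have h6 := mul_le_mul_of_nonneg_left h4 hη.le
    have h7 : 0 ≤ K * (η * τ) * Q := by positivity
    linarith
  -- Dividing by the lower bound on `Q` gives `15 / 2 * 9 / 5 = 13.5`, rounded up to `14`.
  have h6 : 15 / 2 * F ≤ 14 * (μ * F * Real.exp (-(μ * η * K * R / 2))) * (η * (K * Q)) := by
    have h7 : Real.exp (-(μ * η * K * R / 2)) * q ^ R = 1 := by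
      rw [hqR, ← Real.exp_add]; simp
    have h8 := mul_le_mul_of_nonneg_left hQlow
      (by positivity : 0 ≤ F * Real.exp (-(μ * η * K * R / 2)))
    have h9 : F * Real.exp (-(μ * η * K * R / 2)) * (q ^ R / 3) = F / 3 := by
      linear_combination F / 3 * h7
    linarith
  rw [div_le_iff₀ (by positivity)]
  refine le_of_mul_le_mul_left ?_ hη
  linarith

end ScaffoldRun

end

/-! ### Choice of the step size. -/

noncomputable section

/-- The step size conditions follow from a bound on the inverse step size. -/
lemma step_size_bounds {β δ κ η : ℝ} {K : ℕ} (hβ : 0 < β) (hδ : 0 ≤ δ) (hκ : 0 ≤ κ) (hη : 0 < η)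
    (h : η * (10 * β + 22 * δ * K + κ) ≤ 1) :
    10 * β * η ≤ 1 ∧ 22 * δ * K * η ≤ 1 ∧ κ * η ≤ 1 ∧ (15 * K * δ + 8 * β) * η ≤ 1 := by
  have h1 : 0 ≤ β * η := by positivity
  have h2 : 0 ≤ δ * K * η := by positivity
  have h3 : 0 ≤ κ * η := by positivity
  refine ⟨?_, ?_, ?_, ?_⟩ <;> linarith

lemma div_add_noise_le {β σ N κ ν c : ℝ} (hκ : 0 < κ) (hν : 0 ≤ ν)
    (h : β * σ ^ 2 / N ≤ c * (κ + ν)) : 1 / (κ + ν) * β * σ ^ 2 / N ≤ c := by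
  have : 1 / (κ + ν) * β * σ ^ 2 / N = β * σ ^ 2 / N / (κ + ν) := by ring
  rw [this, div_le_iff₀ (by positivity)]
  exact h

lemma one_le_log_exp_one_add {x : ℝ} (hx : 0 ≤ x) : 1 ≤ Real.log (Real.exp 1 + x) := by
  rw [Real.le_log_iff_exp_le (by positivity)]
  linarith

lemma mul_exp_neg_log_le {x : ℝ} (hx : 0 ≤ x) :
    x * Real.exp (-Real.log (Real.exp 1 + x)) ≤ 1 := by
  rw [Real.exp_neg, Real.exp_log (by positivity), ← div_eq_mul_inv, div_le_one (by positivity)]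
  linarith [Real.exp_pos 1]

/-- The step size is the smaller of `1 / κ` and `2 L / (μ K R)`: the latter reduces the exponential
to `exp (-L)`, which brings the initial gap down to the noise level `V`. The two lower bounds on `R
K` add up to `κ ≤ μ K R`. -/
lemma exists_step_size_strongly_convex {N K R : ℕ} {β δ σ μ F : ℝ} (hN : 1 ≤ N) (hK : 1 ≤ K)
    (hR : 1 ≤ R) (hβ : 0 < β) (hδ : 0 ≤ δ) (hμ : 0 < μ) (hF : 0 ≤ F)
    (h1 : 20 * β / μ ≤ R * K) (h2 : (44 * δ * K + 20 * μ * K) / μ ≤ R * K) :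
    ∃ η : ℝ, 0 < η ∧ η * (10 * β + 22 * δ * K + 10 * μ * K) ≤ 1 ∧ 1 ≤ μ * η * K * R ∧
      14 * (μ * F * Real.exp (-(μ * η * K * R / 2))) + 24 * (η * β * σ ^ 2 / N) ≤
        1200 * (β * σ ^ 2 / (μ * R * K * N) *
            Real.log (Real.exp 1 + μ ^ 2 * R * K * N * F / (β * σ ^ 2))
          + μ * F * Real.exp (-(μ / (20 * β + 44 * δ * K + 20 * μ * K)) * (R * K))) := by
  have hN' : (0 : ℝ) < N := by positivity
  have hK' : (0 : ℝ) < K := by positivity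
  have hR' : (0 : ℝ) < R := by positivity
  set κ := 10 * β + 22 * δ * K + 10 * μ * K with hκ
  have hκ0 : 0 < κ := by positivity
  have hκe : 20 * β + 44 * δ * K + 20 * μ * K = 2 * κ := by rw [hκ]; ring
  have hRK : κ ≤ μ * K * R := by
    rw [div_le_iff₀ hμ] at h1 h2
    linarith
  set X := μ ^ 2 * R * K * N * F / (β * σ ^ 2) with hX
  have hX0 : 0 ≤ X := by positivity
  set L := Real.log (Real.exp 1 + X) with hL
  have hL1 : 1 ≤ L := one_le_log_exp_one_add hX0
  set V := β * σ ^ 2 / (μ * R * K * N) with hV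
  have hV0 : 0 ≤ V := by positivity
  have hVL : 0 ≤ V * L := by positivity
  rw [hκe]
  set T := μ * F * Real.exp (-(μ / (2 * κ)) * (R * K)) with hT
  have hT0 : 0 ≤ T := by positivity
  -- Without noise the first choice is always right, and division by zero makes `V` vanish.
  by_cases hcase : σ = 0 ∨ 1 / κ ≤ 2 * L / (μ * K * R)
  · refine ⟨1 / κ, by positivity, by rw [one_div_mul_cancel hκ0.ne'], ?_, ?_⟩
    · have : μ * (1 / κ) * K * R = μ * K * R / κ := by ring
      rwa [this, one_le_div hκ0]
    · have e1 : μ * F * Real.exp (-(μ * (1 / κ) * K * R / 2)) = T := by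
        rw [hT]; congr 2; field_simp
      have e2 : 1 / κ * β * σ ^ 2 / N ≤ 2 * (V * L) := by
        rcases hcase with h | h
        · rw [h]; simp; positivity
        · calc 1 / κ * β * σ ^ 2 / N = 1 / κ * (β * σ ^ 2 / N) := by ring
            _ ≤ 2 * L / (μ * K * R) * (β * σ ^ 2 / N) := by gcongr
            _ = _ := by rw [hV]; field_simp
      rw [e1]
      linarith
  · push Not at hcase
    obtain ⟨hσ, hlt⟩ := hcase
    have e0 : μ * (2 * L / (μ * K * R)) * K * R = 2 * L := by field_simp
    refine ⟨2 * L / (μ * K * R), by positivity, ?_, by rw [e0]; linarith, ?_⟩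
    · have := mul_le_mul_of_nonneg_right hlt.le hκ0.le
      rwa [one_div_mul_cancel hκ0.ne'] at this
    · have e1 : μ * F = X * V := by rw [hX, hV]; field_simp
      have e2 : μ * F * Real.exp (-(2 * L / 2)) ≤ V := by
        rw [e1, mul_div_cancel_left₀ L two_ne_zero]
        have := mul_le_mul_of_nonneg_left (mul_exp_neg_log_le hX0) hV0
        rw [← hL] at this
        linarith
      have e3 : 2 * L / (μ * K * R) * β * σ ^ 2 / N = 2 * (V * L) := by rw [hV]; field_simp
      have e4 : V ≤ V * L := le_mul_of_one_le_right hV0 hL1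
      rw [e0, e3]
      linarith

lemma exists_step_size_strongly_convex_accuracy {N K R : ℕ} {β δ σ μ F ε : ℝ} (hN : 1 ≤ N)
    (hK : 1 ≤ K) (hβ : 0 < β) (hδ : 0 ≤ δ) (hμ : 0 < μ) (hF : 0 ≤ F) (hε : 0 < ε)
    (h : 1200 * (β * σ ^ 2 / (μ * K * N * ε) + (β + δ * K) / (μ * K) + 1) *
        Real.log (Real.exp 1 + μ * F / ε) ≤ R) :
    1 ≤ R ∧ ∃ η : ℝ, 0 < η ∧ η * (10 * β + 22 * δ * K + 10 * μ * K) ≤ 1 ∧ 1 ≤ μ * η * K * R ∧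
      14 * (μ * F * Real.exp (-(μ * η * K * R / 2))) + 24 * (η * β * σ ^ 2 / N) < ε := by
  have hN' : (0 : ℝ) < N := by positivity
  have hK' : (0 : ℝ) < K := by positivity
  have hX0 : 0 ≤ μ * F / ε := by positivity
  set L := Real.log (Real.exp 1 + μ * F / ε) with hL
  have hL1 : 1 ≤ L := one_le_log_exp_one_add hX0
  set κ := 10 * β + 22 * δ * K + 10 * μ * K with hκ
  have hκ0 : 0 < κ := by positivity
  -- Chosen so that the noise term `24 η β σ² / N` is at most `ε / 4`.
  set ν := 96 * (β * σ ^ 2 / N) / ε with hν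
  have hν0 : 0 ≤ ν := by positivity
  have hκν : 0 < κ + ν := by positivity
  have hR : 12 * L * (κ + ν) ≤ μ * K * R := by
    have e1 := mul_le_mul_of_nonneg_left h (by positivity : 0 ≤ μ * K)
    have e2 : μ * K * (1200 * (β * σ ^ 2 / (μ * K * N * ε) + (β + δ * K) / (μ * K) + 1) * L)
        = 1200 * (β * σ ^ 2 / N / ε + (β + δ * K) + μ * K) * L := by field_simp
    rw [e2] at e1
    refine le_trans ?_ e1
    have e3 : κ + ν ≤ 100 * (β * σ ^ 2 / N / ε + (β + δ * K) + μ * K) := by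
      have e4 : 0 ≤ δ * K := by positivity
      have e5 : 0 ≤ μ * K := by positivity
      have e6 : 0 ≤ β * σ ^ 2 / N / ε := by positivity
      have e7 : ν = 96 * (β * σ ^ 2 / N / ε) := by rw [hν]; ring
      rw [e7, hκ]
      linarith
    have := mul_le_mul_of_nonneg_left e3 (by positivity : 0 ≤ 12 * L)
    linarith
  -- For `R = 0` there would be no output distribution at all.
  have hR1 : 1 ≤ R := by
    rw [Nat.one_le_iff_ne_zero]
    rintro rfl
    have : 0 < 12 * L * (κ + ν) := by positivity
    simp at hR
    linarith
  have hlong : 12 * L ≤ μ * (1 / (κ + ν)) * K * R := by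
    have : μ * (1 / (κ + ν)) * K * R = μ * K * R / (κ + ν) := by ring
    rwa [this, le_div_iff₀ hκν]
  refine ⟨hR1, 1 / (κ + ν), by positivity, ?_, by linarith, ?_⟩
  · rw [one_div_mul_eq_div, div_le_one hκν]; linarith
  · have e1 : 1 / (κ + ν) * β * σ ^ 2 / N ≤ ε / 96 := by
      refine div_add_noise_le hκ0 hν0 ?_
      have : ε / 96 * ν = β * σ ^ 2 / N := by rw [hν]; field_simp
      have : 0 ≤ ε / 96 * κ := by positivity
      linarith
    -- The exponent is at least `6 L ≥ 5 + L`; then `exp (-L)` reduces `μ F` to `ε`, and `exp (-5) ≤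
    -- 1 / 32` beats the factor `14`.
    have e2 : Real.exp (-(μ * (1 / (κ + ν)) * K * R / 2)) ≤ Real.exp (-5) * Real.exp (-L) := by
      rw [← Real.exp_add]
      exact Real.exp_le_exp.2 (by linarith)
    have e3 : Real.exp (-5) ≤ 1 / 32 := by
      have : (2 : ℝ) ^ 5 ≤ Real.exp 1 ^ 5 := by
        gcongr; linarith [Real.add_one_le_exp 1]
      rw [← Real.exp_nat_mul] at this
      rw [Real.exp_neg, ← one_div]
      refine one_div_le_one_div_of_le (by norm_num) ?_
      norm_num at this
      exact this
    have e4 : μ * F * Real.exp (-L) ≤ ε := by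
      have := mul_le_mul_of_nonneg_left (mul_exp_neg_log_le hX0) hε.le
      rw [← hL] at this
      have e5 : ε * (μ * F / ε * Real.exp (-L)) = μ * F * Real.exp (-L) := by field_simp
      linarith
    have e5 : μ * F * Real.exp (-(μ * (1 / (κ + ν)) * K * R / 2)) ≤ 1 / 32 * ε := by
      calc _ ≤ μ * F * (Real.exp (-5) * Real.exp (-L)) := by gcongr
        _ = Real.exp (-5) * (μ * F * Real.exp (-L)) := by ring
        _ ≤ 1 / 32 * ε := by gcongr
    linarith

lemma exists_step_size_weakly_convex {N K R : ℕ} {β δ σ F : ℝ} (hN : 1 ≤ N) (hK : 1 ≤ K)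
    (hR : 1 ≤ R) (hβ : 0 < β) (hδ : 0 ≤ δ) (hσ : 0 ≤ σ) (hF : 0 < F) :
    ∃ η : ℝ, 0 < η ∧ η * (10 * β + 22 * δ * K + 0) ≤ 1 ∧
      4 * F / (η * R * K) + 9 * (η * β * σ ^ 2 / N) ≤
        1200 * (σ * Real.sqrt (β * F) / Real.sqrt (R * K * N) + (β + δ * K) * F / (R * K)) := by
  have hN' : (0 : ℝ) < N := by positivity
  have hK' : (0 : ℝ) < K := by positivity
  have hR' : (0 : ℝ) < R := by positivity
  set s := Real.sqrt (β * F) with hs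
  set t := Real.sqrt (R * K * N) with ht
  have hs0 : 0 < s := Real.sqrt_pos.2 (by positivity)
  have ht0 : 0 < t := Real.sqrt_pos.2 (by positivity)
  have hs2 : s ^ 2 = β * F := Real.sq_sqrt (by positivity)
  have ht2 : t ^ 2 = R * K * N := Real.sq_sqrt (by positivity)
  set κ := 10 * β + 22 * δ * K with hκ
  have hκ0 : 0 < κ := by positivity
  -- This value equalises `F ν / (R K)` and `β σ² / (N ν)`; both become `σ s / t`, the leading term
  -- of the rate.
  set ν := σ * s * t / (F * N) with hν
  have hν0 : 0 ≤ ν := by positivity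
  have hκν : 0 < κ + ν := by positivity
  refine ⟨1 / (κ + ν), by positivity, ?_, ?_⟩
  · rw [one_div_mul_eq_div, div_le_one hκν]; linarith
  · have e1 : 4 * F / (1 / (κ + ν) * R * K) = 4 * (κ * F / (R * K)) + 4 * (σ * s / t) := by
      have e2 : ν * F / (R * K) = σ * s / t := by
        rw [hν, div_eq_div_iff (by positivity) (by positivity)]
        field_simp
        rw [ht2]
        ring
      rw [← e2]
      field_simp
    have e2 : 1 / (κ + ν) * β * σ ^ 2 / N ≤ σ * s / t := by
      refine div_add_noise_le hκ0 hν0 ?_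
      have e3 : σ * s / t * ν = β * σ ^ 2 / N := by
        rw [hν]
        field_simp
        rw [hs2]
        ring
      have : 0 ≤ σ * s / t * κ := by positivity
      linarith
    have e3 : κ * F / (R * K) ≤ 22 * ((β + δ * K) * F / (R * K)) := by
      rw [← mul_div_assoc, ← mul_assoc]
      gcongr
      rw [hκ]
      linarith
    have e4 : 0 ≤ σ * s / t := by positivity
    have e5 : 0 ≤ (β + δ * K) * F / (R * K) := by positivity
    rw [e1]
    linarith

lemma exists_step_size_weakly_convex_accuracy {N K R : ℕ} {β δ σ F ε : ℝ} (hN : 1 ≤ N)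
    (hK : 1 ≤ K) (hR : 1 ≤ R) (hβ : 0 < β) (hδ : 0 ≤ δ) (hF : 0 ≤ F) (hε : 0 < ε)
    (h : 1200 * (β * σ ^ 2 * F / (K * N * ε ^ 2) + (β + δ * K) * F / (K * ε)) ≤ R) :
    ∃ η : ℝ, 0 < η ∧ η * (10 * β + 22 * δ * K + 0) ≤ 1 ∧
      4 * F / (η * R * K) + 9 * (η * β * σ ^ 2 / N) < ε := by
  have hN' : (0 : ℝ) < N := by positivity
  have hK' : (0 : ℝ) < K := by positivity
  have hR' : (0 : ℝ) < R := by positivity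
  set κ := 10 * β + 22 * δ * K with hκ
  have hκ0 : 0 < κ := by positivity
  -- Chosen so that `9 η β σ² / N` is at most `ε / 4`; the bound on `R` leaves another `ε / 4` for
  -- the term in `F`.
  set ν := 36 * (β * σ ^ 2 / N) / ε with hν
  have hν0 : 0 ≤ ν := by positivity
  have hκν : 0 < κ + ν := by positivity
  refine ⟨1 / (κ + ν), by positivity, ?_, ?_⟩
  · rw [one_div_mul_eq_div, div_le_one hκν]; linarith
  · have e1 : 1 / (κ + ν) * β * σ ^ 2 / N ≤ ε / 36 := by
      refine div_add_noise_le hκ0 hν0 ?_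
      have : ε / 36 * ν = β * σ ^ 2 / N := by rw [hν]; field_simp
      have : 0 ≤ ε / 36 * κ := by positivity
      linarith
    have e2 : 4 * F / (1 / (κ + ν) * R * K) ≤ ε / 4 := by
      have e3 : 4 * F / (1 / (κ + ν) * R * K) = 4 * F * (κ + ν) / (R * K) := by field_simp
      rw [e3, div_le_iff₀ (by positivity)]
      have e4 := mul_le_mul_of_nonneg_left h (by positivity : 0 ≤ ε / 4 * K)
      have e5 : ε / 4 * K * (1200 * (β * σ ^ 2 * F / (K * N * ε ^ 2) + (β + δ * K) * F / (K * ε)))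
          = 300 * (F * (β * σ ^ 2 / N / ε + (β + δ * K))) := by field_simp; ring
      rw [e5] at e4
      have e6 : κ + ν ≤ 36 * (β * σ ^ 2 / N / ε + (β + δ * K)) := by
        have e7 : 0 ≤ δ * K := by positivity
        have e8 : ν = 36 * (β * σ ^ 2 / N / ε) := by rw [hν]; ring
        rw [e8, hκ]
        linarith
      have e7 := mul_le_mul_of_nonneg_left e6 hF
      have e8 : 0 ≤ F * (β * σ ^ 2 / N / ε + (β + δ * K)) := by positivity
      linarith
    linarith

end

/-! ### The four convergence statements. -/

theorem theorem4 :
    ∃ C : ℝ, 0 < C ∧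
    -- strongly convex clients: convergence rate
    (∀ (N K R : ℕ) (β δ σ μ F : ℝ), 1 ≤ N → 1 ≤ K → 1 ≤ R →
      0 < β → 0 ≤ δ → 0 ≤ σ → 0 < μ → 0 ≤ F →
      20 * β / μ ≤ R * K → (44 * δ * K + 20 * μ * K) / μ ≤ R * K →
      ∃ (η : ℝ) (p : PMF (Fin R × Fin K)), 0 < η ∧
        10 * β * η ≤ 1 ∧ 22 * δ * K * η ≤ 1 ∧ 10 * μ * K * η ≤ 1 ∧
        (15 * K * δ + 8 * β) * η ≤ 1 ∧
        ∀ (d : ℕ) (S : ScaffoldRun N K R d β δ σ η 1 p) (fstar : ℝ),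
          (∀ i, IsMuConvex μ (S.f i)) →
          (∀ x, fstar ≤ S.obj x) → S.obj S.x₀ - fstar ≤ F →
          Integrable S.sqGrad S.P ∧
          ∫ ω, S.sqGrad ω ∂S.P ≤
            C * (β * σ ^ 2 / (μ * R * K * N) *
                  Real.log (Real.exp 1 + μ ^ 2 * R * K * N * F / (β * σ ^ 2))
              + μ * F * Real.exp (-(μ / (20 * β + 44 * δ * K + 20 * μ * K)) * (R * K)))) ∧
    -- strongly convex clients: number of rounds for accuracy `ε`
    (∀ (N K R : ℕ) (β δ σ μ F ε : ℝ), 1 ≤ N → 1 ≤ K →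
      0 < β → 0 ≤ δ → 0 ≤ σ → 0 < μ → 0 ≤ F → 0 < ε →
      C * (β * σ ^ 2 / (μ * K * N * ε) + (β + δ * K) / (μ * K) + 1) *
        Real.log (Real.exp 1 + μ * F / ε) ≤ R →
      ∃ (η : ℝ) (p : PMF (Fin R × Fin K)), 0 < η ∧
        10 * β * η ≤ 1 ∧ 22 * δ * K * η ≤ 1 ∧ 10 * μ * K * η ≤ 1 ∧
        (15 * K * δ + 8 * β) * η ≤ 1 ∧
        ∀ (d : ℕ) (S : ScaffoldRun N K R d β δ σ η 1 p) (fstar : ℝ),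
          (∀ i, IsMuConvex μ (S.f i)) →
          (∀ x, fstar ≤ S.obj x) → S.obj S.x₀ - fstar ≤ F →
          Integrable S.sqGrad S.P ∧ ∫ ω, S.sqGrad ω ∂S.P < ε) ∧
    -- weakly convex objective: convergence rate
    (∀ (N K R : ℕ) (β δ σ F : ℝ), 1 ≤ N → 1 ≤ K → 1 ≤ R →
      0 < β → 0 ≤ δ → 0 ≤ σ → 0 < F →
      ∃ (η : ℝ) (p : PMF (Fin R × Fin K)), 0 < η ∧
        10 * β * η ≤ 1 ∧ 22 * δ * K * η ≤ 1 ∧ (15 * K * δ + 8 * β) * η ≤ 1 ∧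
        ∀ (d : ℕ) (S : ScaffoldRun N K R d β δ σ η 1 p) (fstar : ℝ),
          IsWeaklyConvex δ S.obj →
          (∀ᵐ ω ∂S.P, fstar ≤ S.obj (S.finalModel ω)) → S.obj S.x₀ - fstar ≤ F →
          Integrable S.sqGrad S.P ∧
          ∫ ω, S.sqGrad ω ∂S.P ≤
            C * (σ * Real.sqrt (β * F) / Real.sqrt (R * K * N)
              + (β + δ * K) * F / (R * K))) ∧
    -- weakly convex objective: number of rounds for accuracy `ε`
    (∀ (N K R : ℕ) (β δ σ F ε : ℝ), 1 ≤ N → 1 ≤ K → 1 ≤ R →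
      0 < β → 0 ≤ δ → 0 ≤ σ → 0 ≤ F → 0 < ε →
      C * (β * σ ^ 2 * F / (K * N * ε ^ 2) + (β + δ * K) * F / (K * ε)) ≤ R →
      ∃ (η : ℝ) (p : PMF (Fin R × Fin K)), 0 < η ∧
        10 * β * η ≤ 1 ∧ 22 * δ * K * η ≤ 1 ∧ (15 * K * δ + 8 * β) * η ≤ 1 ∧
        ∀ (d : ℕ) (S : ScaffoldRun N K R d β δ σ η 1 p) (fstar : ℝ),
          IsWeaklyConvex δ S.obj →
          (∀ᵐ ω ∂S.P, fstar ≤ S.obj (S.finalModel ω)) → S.obj S.x₀ - fstar ≤ F →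
          Integrable S.sqGrad S.P ∧ ∫ ω, S.sqGrad ω ∂S.P < ε) := by
  -- The constant is `12 * 100` from `exists_step_size_strongly_convex_accuracy`; the other parts
  -- have room to spare.
  refine ⟨1200, by norm_num, ?_, ?_, ?_, ?_⟩
  · intro N K R β δ σ μ F hN hK hR hβ hδ _ hμ hF h1 h2
    obtain ⟨η, hη, hstep, hlong, hbound⟩ :=
      exists_step_size_strongly_convex (σ := σ) hN hK hR hβ hδ hμ hF h1 h2
    obtain ⟨p, hp⟩ := exists_geometric_pmf hR hK (Real.exp_pos (μ * η * K / 2))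
    obtain ⟨s1, s2, s3, s4⟩ := step_size_bounds hβ hδ (by positivity) hη hstep
    refine ⟨η, p, hη, s1, s2, s3, s4, fun d S fstar hs hstar hF' =>
      ⟨(S.integral_sqGrad hN).1, (S.integral_sqGrad_le_of_isMuConvex hN hK hR hη hδ hβ s1 s2 hμ s3
        hlong hp hs hstar hF').trans hbound⟩⟩
  · intro N K R β δ σ μ F ε hN hK hβ hδ _ hμ hF hε h
    obtain ⟨hR, η, hη, hstep, hlong, hbound⟩ :=
      exists_step_size_strongly_convex_accuracy hN hK hβ hδ hμ hF hε h
    obtain ⟨p, hp⟩ := exists_geometric_pmf hR hK (Real.exp_pos (μ * η * K / 2))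
    obtain ⟨s1, s2, s3, s4⟩ := step_size_bounds hβ hδ (by positivity) hη hstep
    refine ⟨η, p, hη, s1, s2, s3, s4, fun d S fstar hs hstar hF' =>
      ⟨(S.integral_sqGrad hN).1, (S.integral_sqGrad_le_of_isMuConvex hN hK hR hη hδ hβ s1 s2 hμ s3
        hlong hp hs hstar hF').trans_lt hbound⟩⟩
  · intro N K R β δ σ F hN hK hR hβ hδ hσ hF
    obtain ⟨η, hη, hstep, hbound⟩ := exists_step_size_weakly_convex hN hK hR hβ hδ hσ hF
    obtain ⟨p, hp⟩ := exists_geometric_pmf hR hK one_pos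
    obtain ⟨s1, s2, _, s4⟩ := step_size_bounds hβ hδ le_rfl hη hstep
    refine ⟨η, p, hη, s1, s2, s4, fun d S fstar hw hstar hF' =>
      ⟨(S.integral_sqGrad hN).1, (S.integral_sqGrad_le_of_isWeaklyConvex hN hK hR hη hδ hβ s1 s2
        hp hw hF.le hstar hF').trans hbound⟩⟩
  · intro N K R β δ σ F ε hN hK hR hβ hδ _ hF hε h
    obtain ⟨η, hη, hstep, hbound⟩ :=
      exists_step_size_weakly_convex_accuracy hN hK hR hβ hδ hF hε h
    obtain ⟨p, hp⟩ := exists_geometric_pmf hR hK one_pos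
    obtain ⟨s1, s2, _, s4⟩ := step_size_bounds hβ hδ le_rfl hη hstep
    refine ⟨η, p, hη, s1, s2, s4, fun d S fstar hw hstar hF' =>
      ⟨(S.integral_sqGrad hN).1, (S.integral_sqGrad_le_of_isWeaklyConvex hN hK hR hη hδ hβ s1 s2
        hp hw hF hstar hF').trans_lt hbound⟩⟩
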